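/- Let $\mathcal F$ be a germ of holomorphic foliation at $0\in\mathbb C^2$, given by a germ of vector field $X$ with $\mathrm{Sing}(X)\subset\{0\}$, and let $\hat\Gamma$ be a germ of reduced curve at $0$. Definitions. If $\hat\Gamma$ is singular, its minimal desingularization is the minimal finite composition $\pi$ of point blow-ups over $0$ such that, at every point of $E=\pi^{-1}(0)$, the strict transform of $\hat\Gamma$ is empty or consists of one non-singular branch, which meets only one irreducible component of $E$ and is transverse to it. For an irreducible component $\gamma$ of $\hat\Gamma$, let $P_\gamma$ be the point where its strict transform meets $E$ and let $D_\gamma$ be the irreducible component of $E$ through $P_\gamma$. Write $\pi^*\mathcal F$ for the strict transform of $\mathcal F$ (the pull-back foliation with isolated singularities), given near $P_\gamma$ by a vector field $Y$ with isolated zeros, and let $e=0$ be a reduced local equation of $D_\gamma$ at $P_\gamma$. Let $\kappa_{P_\gamma}(\pi^*\mathcal F,D_\gamma)$ be the tangency order $\dim_{\mathbb C}\mathcal O_{P_\gamma}/(e,Y(e))$ if $D_\gamma$ is not invariant for $\pi^*\mathcal F$, and the vanishing order at $P_\gamma$ of the restriction $Y|_{D_\gamma}$ if $D_\gamma$ is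 invariant. A normal-crossings divisor at a point is a union of zero, one or two non-singular irreducible germs of curve through the point, mutually transverse in the last case. The curve $\hat\Gamma$ is weakly isolated for $\mathcal F$ if it is singular and $\mathcal F$-invariant and $\hat\Gamma=\Gamma\cup\overline\Gamma$, where $\overline\Gamma$ is a normal-crossings divisor at $0$, $\Gamma\cap\overline\Gamma\subset\{0\}$, and $\kappa_{P_\gamma}(\pi^*\mathcal F,D_\gamma)\ge 1$ for every irreducible component $\gamma$ of $\Gamma$. Proposition. Suppose that $\hat\Gamma$ is weakly isolated for $\mathcal F$. Let $\pi_1$ be the blow-up of the origin, let $P\in\pi_1^{-1}(0)$, and let $\hat\Gamma_P$ be the (reduced) union of the irreducible components through $P$ of the germ at $P$ of the total transform $\pi_1^{-1}(\hat\Gamma)$ that are invariant for $\pi_1^*\mathcal F$. If $\hat\Gamma_P$ is singular at $P$, then $\hat\Gamma_P$ is weakly isolated for $\pi_1^*\mathcal F$ (as a germ at $P$). -/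

import Mathlib

open scoped NNReal ENNReal

noncomputable section

namespace FolGerm

/-! ### Convergent power series -/

/-- A power series converges (absolutely) on some polydisc of positive radius. -/
def IsConvergent {σ : Type} (f : MvPowerSeries σ ℂ) : Prop :=
  ∃ r : ℝ≥0, 0 < r ∧ Summable fun n : σ →₀ ℕ => ‖MvPowerSeries.coeff n f‖₊ * r ^ n.degree

/-- The sum `∑ |aₙ| r^|n|`, with values in `[0, ∞]`; used only to prove closure properties. -/
def wsum {σ : Type} (r : ℝ≥0) (f : MvPowerSeries σ ℂ) : ℝ≥0∞ :=
  ∑' n : σ →₀ ℕ, ‖MvPowerSeries.coeff n f‖ₑ * (r : ℝ≥0∞) ^ n.degree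

theorem isConvergent_iff {σ : Type} (f : MvPowerSeries σ ℂ) :
    IsConvergent f ↔ ∃ r : ℝ≥0, 0 < r ∧ wsum r f ≠ ⊤ := by
  unfold IsConvergent wsum
  refine exists_congr fun r => and_congr_right fun _ => ?_
  rw [← ENNReal.tsum_coe_ne_top_iff_summable]
  simp [enorm_eq_nnnorm]

theorem wsum_mono {σ : Type} {r s : ℝ≥0} (h : r ≤ s) (f : MvPowerSeries σ ℂ) :
    wsum r f ≤ wsum s f := by
  unfold wsum
  refine ENNReal.tsum_le_tsum fun n => ?_
  gcongr

theorem wsum_add {σ : Type} (r : ℝ≥0) (f g : MvPowerSeries σ ℂ) :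
    wsum r (f + g) ≤ wsum r f + wsum r g := by
  unfold wsum
  rw [← ENNReal.tsum_add]
  refine ENNReal.tsum_le_tsum fun n => ?_
  rw [← add_mul, map_add]
  gcongr
  exact enorm_add_le _ _

theorem wsum_monomial {σ : Type} (r : ℝ≥0) (n : σ →₀ ℕ) (c : ℂ) :
    wsum r (MvPowerSeries.monomial n c) = ‖c‖ₑ * (r : ℝ≥0∞) ^ n.degree := by
  classical
  unfold wsum
  rw [tsum_eq_single n]
  · simp
  · intro m hm
    simp [MvPowerSeries.coeff_monomial, hm]

theorem wsum_mul {σ : Type} (r : ℝ≥0) (f g : MvPowerSeries σ ℂ) :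
    wsum r (f * g) ≤ wsum r f * wsum r g := by
  classical
  unfold wsum
  calc _ ≤ ∑' n : σ →₀ ℕ, ∑ p ∈ Finset.HasAntidiagonal.antidiagonal n,
        (‖MvPowerSeries.coeff p.1 f‖ₑ * (r : ℝ≥0∞) ^ p.1.degree) *
        (‖MvPowerSeries.coeff p.2 g‖ₑ * (r : ℝ≥0∞) ^ p.2.degree) := by
        refine ENNReal.tsum_le_tsum fun n => ?_
        rw [MvPowerSeries.coeff_mul]
        refine (mul_le_mul_left (enorm_sum_le _ _) _).trans ?_
        rw [Finset.sum_mul]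
        refine Finset.sum_le_sum fun p hp => ?_
        rw [← Finset.HasAntidiagonal.mem_antidiagonal.1 hp, enorm_mul, map_add, pow_add]
        exact le_of_eq (by ring)
    _ = ∑' q : Σ n : σ →₀ ℕ, Finset.HasAntidiagonal.antidiagonal n,
        (‖MvPowerSeries.coeff q.2.1.1 f‖ₑ * (r : ℝ≥0∞) ^ q.2.1.1.degree) *
        (‖MvPowerSeries.coeff q.2.1.2 g‖ₑ * (r : ℝ≥0∞) ^ q.2.1.2.degree) := by
        rw [ENNReal.tsum_sigma']
        refine tsum_congr fun n => ?_
        rw [tsum_fintype]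
        exact (Finset.sum_coe_sort (Finset.HasAntidiagonal.antidiagonal n) (fun p : (σ →₀ ℕ) × (σ →₀ ℕ) =>
          (‖MvPowerSeries.coeff p.1 f‖ₑ * (r : ℝ≥0∞) ^ p.1.degree) *
          (‖MvPowerSeries.coeff p.2 g‖ₑ * (r : ℝ≥0∞) ^ p.2.degree))).symm
    _ = ∑' p : (σ →₀ ℕ) × (σ →₀ ℕ),
        (‖MvPowerSeries.coeff p.1 f‖ₑ * (r : ℝ≥0∞) ^ p.1.degree) *
        (‖MvPowerSeries.coeff p.2 g‖ₑ * (r : ℝ≥0∞) ^ p.2.degree) :=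
        Finset.HasAntidiagonal.sigmaAntidiagonalEquivProd.tsum_eq (fun p : (σ →₀ ℕ) × (σ →₀ ℕ) =>
          (‖MvPowerSeries.coeff p.1 f‖ₑ * (r : ℝ≥0∞) ^ p.1.degree) *
          (‖MvPowerSeries.coeff p.2 g‖ₑ * (r : ℝ≥0∞) ^ p.2.degree))
    _ = _ := by
        rw [ENNReal.tsum_prod (f := fun p q : σ →₀ ℕ =>
          (‖MvPowerSeries.coeff p f‖ₑ * (r : ℝ≥0∞) ^ p.degree) *
          (‖MvPowerSeries.coeff q g‖ₑ * (r : ℝ≥0∞) ^ q.degree)), ← ENNReal.tsum_mul_right]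
        refine tsum_congr fun n => ?_
        rw [ENNReal.tsum_mul_left]
    
theorem wsum_one {σ : Type} (r : ℝ≥0) : wsum r (1 : MvPowerSeries σ ℂ) = 1 := by
  have := wsum_monomial r (0 : σ →₀ ℕ) 1
  simpa using this

theorem wsum_pow {σ : Type} (r : ℝ≥0) (f : MvPowerSeries σ ℂ) (k : ℕ) :
    wsum r (f ^ k) ≤ wsum r f ^ k := by
  induction k with
  | zero => simp [wsum_one]
  | succ k ih =>
    rw [pow_succ, pow_succ]
    exact (wsum_mul _ _ _).trans (by gcongr)

/-- The ring `ℂ{x, y}` of convergent power series, that is, of germs of holomorphic functions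
at the origin of `ℂ²`, as a subalgebra of the algebra of formal power series. -/
def convergentSeries : Subalgebra ℂ (MvPowerSeries (Fin 2) ℂ) where
  carrier := {f | IsConvergent f}
  mul_mem' := by
    intro f g hf hg
    simp only [Set.mem_ofPred_eq, isConvergent_iff] at *
    obtain ⟨r, hr, hf⟩ := hf
    obtain ⟨s, hs, hg⟩ := hg
    refine ⟨min r s, lt_min hr hs, ne_top_of_le_ne_top ?_ (wsum_mul _ _ _)⟩
    exact ENNReal.mul_ne_top (ne_top_of_le_ne_top hf (wsum_mono (min_le_left _ _) _))
      (ne_top_of_le_ne_top hg (wsum_mono (min_le_right _ _) _))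
  add_mem' := by
    intro f g hf hg
    simp only [Set.mem_ofPred_eq, isConvergent_iff] at *
    obtain ⟨r, hr, hf⟩ := hf
    obtain ⟨s, hs, hg⟩ := hg
    refine ⟨min r s, lt_min hr hs, ne_top_of_le_ne_top ?_ (wsum_add _ _ _)⟩
    exact ENNReal.add_ne_top.2 ⟨ne_top_of_le_ne_top hf (wsum_mono (min_le_left _ _) _),
      ne_top_of_le_ne_top hg (wsum_mono (min_le_right _ _) _)⟩
  algebraMap_mem' := by
    intro c
    simp only [Set.mem_ofPred_eq, isConvergent_iff]
    refine ⟨1, one_pos, ?_⟩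
    have := wsum_monomial 1 (0 : Fin 2 →₀ ℕ) c
    change wsum 1 (MvPowerSeries.monomial 0 c) ≠ ⊤
    rw [this]
    simp

/-- `ℂ{x, y}` as a type. -/
abbrev HolGerm : Type := convergentSeries

theorem isConvergent_X (i : Fin 2) : IsConvergent (MvPowerSeries.X i : MvPowerSeries (Fin 2) ℂ) := by
  rw [isConvergent_iff]
  refine ⟨1, one_pos, ?_⟩
  rw [MvPowerSeries.X, wsum_monomial]
  simp

theorem isConvergent_pderiv (i : Fin 2) {f : MvPowerSeries (Fin 2) ℂ} (hf : IsConvergent f) :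
    IsConvergent (MvPowerSeries.pderiv ℂ i f) := by
  rw [isConvergent_iff] at *
  obtain ⟨r, hr, hf⟩ := hf
  refine ⟨r / 2, by positivity, ?_⟩
  have hr' : (r : ℝ≥0∞) ≠ 0 := by simpa using hr.ne'
  have key : (r : ℝ≥0∞) * wsum (r / 2) (MvPowerSeries.pderiv ℂ i f) ≤ wsum r f := by
    unfold wsum
    rw [← ENNReal.tsum_mul_left]
    have hinj : Function.Injective fun n : Fin 2 →₀ ℕ => n + Finsupp.single i 1 :=
      add_left_injective _
    refine le_trans (ENNReal.tsum_le_tsum fun n => ?_) (ENNReal.tsum_comp_le_tsum_of_injective hinj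
      (fun n => ‖MvPowerSeries.coeff n f‖ₑ * (r : ℝ≥0∞) ^ n.degree))
    rw [MvPowerSeries.coeff_pderiv, enorm_mul, map_add, Finsupp.degree_single, pow_add, pow_one]
    have h1 : n i + 1 ≤ 2 ^ n.degree :=
      (Nat.lt_two_pow_self (n := n i)).trans_le
        (Nat.pow_le_pow_right (by norm_num) (Finsupp.le_degree i n))
    have h2 : ‖((n i : ℂ) + 1)‖₊ * (r / 2) ^ n.degree ≤ r ^ n.degree := by
      have h3 : ‖((n i : ℂ) + 1)‖₊ = ((n i + 1 : ℕ) : ℝ≥0) := by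
        rw [← Nat.cast_succ]; exact Complex.nnnorm_natCast _
      rw [h3, div_pow, mul_div_assoc', div_le_iff₀ (by positivity), mul_comm]
      gcongr
      exact_mod_cast h1
    have h4 : ‖((n i : ℂ) + 1)‖ₑ * ((r / 2 : ℝ≥0) : ℝ≥0∞) ^ n.degree ≤ (r : ℝ≥0∞) ^ n.degree := by
      rw [enorm_eq_nnnorm]; exact_mod_cast h2
    calc _ = ‖MvPowerSeries.coeff (n + Finsupp.single i 1) f‖ₑ * ((‖((n i : ℂ) + 1)‖ₑ *
          ((r / 2 : ℝ≥0) : ℝ≥0∞) ^ n.degree) * r) := by ring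
      _ ≤ _ := by gcongr
  intro h
  rw [h, ENNReal.mul_top hr'] at key
  exact hf (top_le_iff.1 key)

/-! ### Germs of functions, vector fields and curves -/

/-- The coordinate functions: `coord 0 = x` and `coord 1 = y`. -/
def coord (i : Fin 2) : HolGerm := ⟨MvPowerSeries.X i, isConvergent_X i⟩

/-- The partial derivatives `∂/∂x` (`i = 0`) and `∂/∂y` (`i = 1`). -/
def partialDeriv (i : Fin 2) (f : HolGerm) : HolGerm :=
  ⟨MvPowerSeries.pderiv ℂ i f.1, isConvergent_pderiv i f.2⟩

/-- A pair `(a, b)` stands for the germ of vector field `a ∂/∂x + b ∂/∂y`. -/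
abbrev VectorField : Type := HolGerm × HolGerm

/-- The derivative `X(f) = a ∂f/∂x + b ∂f/∂y`. -/
def VectorField.apply (X : VectorField) (f : HolGerm) : HolGerm :=
  X.1 * partialDeriv 0 f + X.2 * partialDeriv 1 f

/-- The multiplicity (vanishing order at the origin) `ν₀(f)`. -/
def mult (f : HolGerm) : ℕ∞ := MvPowerSeries.order f.1

/-- The curve `f = 0` is invariant for the foliation given by `X`. -/
def IsInvariant (X : VectorField) (f : HolGerm) : Prop := f ∣ X.apply f

/-- The Jacobian determinant of `f` and `g` at the origin. -/
def jacobianAtZero (f g : HolGerm) : ℂ :=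
  MvPowerSeries.constantCoeff
    (partialDeriv 0 f * partialDeriv 1 g - partialDeriv 1 f * partialDeriv 0 g : HolGerm).1

/-- `f = 0` and `g = 0` are non-singular curves through the origin with distinct tangents. -/
def AreTransverse (f g : HolGerm) : Prop :=
  mult f = 1 ∧ mult g = 1 ∧ jacobianAtZero f g ≠ 0

/-- `v = 0` is a normal-crossings divisor at the origin: the union of zero, one or two non-singular
irreducible curves through the origin, mutually transverse in the last case. -/
def IsNormalCrossings (v : HolGerm) : Prop :=
  IsUnit v ∨ mult v = 1 ∨ ∃ v₁ v₂, v = v₁ * v₂ ∧ AreTransverse v₁ v₂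

/-! ### Indices -/

/-- `α` is a Puiseux parametrization of the irreducible curve `e = 0` of multiplicity `n`: one
of its components is `t ^ n` and the other one has order at least `n`. -/
def IsPuiseuxParametrization (e : HolGerm) (α : Fin 2 → PowerSeries ℂ) : Prop :=
  (∀ i, IsConvergent (α i)) ∧ MvPowerSeries.subst α e.1 = 0 ∧
    ∃ (n : ℕ) (i j : Fin 2), 0 < n ∧ mult e = n ∧ i ≠ j ∧ α i = PowerSeries.X ^ n ∧
      (n : ℕ∞) ≤ (α j).order

/-- The vanishing order `Z(X, γ)` of `α^* X` at the origin, where `α` is a Puiseux parametrization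
of the irreducible invariant curve `γ = {e = 0}`; here `α^* X` is the vector field `h(t) ∂/∂t`
that `α` maps to `X`. -/
def vanishingIndex (X : VectorField) (e : HolGerm) : ℕ∞ :=
  sInf {n | ∃ (α : Fin 2 → PowerSeries ℂ) (h : PowerSeries ℂ), IsPuiseuxParametrization e α ∧
    MvPowerSeries.subst α X.1.1 = h * PowerSeries.derivative ℂ (α 0) ∧
    MvPowerSeries.subst α X.2.1 = h * PowerSeries.derivative ℂ (α 1) ∧ n = h.order}

/-- The tangency order `dim_ℂ ℂ{x, y} / (e, X(e))` of the foliation with the curve `e = 0`. -/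
def tangencyOrder (X : VectorField) (e : HolGerm) : ℕ∞ :=
  Cardinal.toENat (Module.rank ℂ (HolGerm ⧸ Ideal.span {e, X.apply e}))

open Classical in
/-- The index `κ(X, D)` at a point of an exceptional divisor whose irreducible components through
that point have the equations in the set `E`, where `D ∈ E`. -/
def kappa (X : VectorField) (E : Set HolGerm) (D : HolGerm) : ℕ∞ :=
  if IsInvariant X D then
    if ∃ D' ∈ E, D' ≠ D ∧ IsInvariant X D' then vanishingIndex X D - 1 else vanishingIndex X D
  else tangencyOrder X D

/-! ### Blowing up the origin -/

/-- The points of the exceptional divisor of the blow-up of the origin of `ℂ²`, that is, the lines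
through the origin: `slope c` is the line `y = c x` and `vertical` is the line `x = 0`. -/
inductive Direction : Type
  | slope (c : ℂ)
  | vertical

/-- The blow-up in coordinates centred at a point of the exceptional divisor:
`(x, y) ↦ (x, x (y + c))` at `slope c` and `(x, y) ↦ (x y, y)` at `vertical`. -/
def chart : Direction → Fin 2 → MvPowerSeries (Fin 2) ℂ
  | .slope c => ![MvPowerSeries.X 0, MvPowerSeries.X 0 * (MvPowerSeries.X 1 + MvPowerSeries.C c)]
  | .vertical => ![MvPowerSeries.X 0 * MvPowerSeries.X 1, MvPowerSeries.X 1]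

theorem hasSubst_chart (d : Direction) : MvPowerSeries.HasSubst (chart d) := by
  refine MvPowerSeries.hasSubst_of_constantCoeff_zero fun i => ?_
  cases d <;> fin_cases i <;> simp [chart]

theorem wsum_X (r : ℝ≥0) (i : Fin 2) :
    wsum r (MvPowerSeries.X i : MvPowerSeries (Fin 2) ℂ) = r := by
  rw [MvPowerSeries.X, wsum_monomial]
  simp

theorem wsum_C (r : ℝ≥0) (c : ℂ) :
    wsum r (MvPowerSeries.C c : MvPowerSeries (Fin 2) ℂ) = ‖c‖ₑ := by
  change wsum r (MvPowerSeries.monomial 0 c) = _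
  rw [wsum_monomial]
  simp

theorem wsum_chart_le (d : Direction) (r : ℝ≥0) (hr : 0 < r) :
    ∃ s : ℝ≥0, 0 < s ∧ ∀ i, wsum s (chart d i) ≤ r := by
  cases d with
  | slope c =>
    have hpos : 0 < 1 + ‖c‖₊ := by positivity
    refine ⟨min 1 (r / (1 + ‖c‖₊)), lt_min one_pos (by positivity), fun i => ?_⟩
    set s := min 1 (r / (1 + ‖c‖₊)) with hs
    have h1 : s ≤ 1 := min_le_left _ _
    have h2 : s * (1 + ‖c‖₊) ≤ r := by
      rw [← le_div_iff₀ hpos]; exact min_le_right _ _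
    have h3 : s * (s + ‖c‖₊) ≤ r := le_trans (by gcongr) h2
    have h4 : s ≤ r := le_trans (le_mul_of_one_le_right (by positivity) (by simp)) h2
    fin_cases i
    · simp only [chart, Fin.zero_eta, Matrix.cons_val_zero, wsum_X]
      exact_mod_cast h4
    · simp only [chart, Fin.mk_one, Matrix.cons_val_one, Matrix.cons_val_fin_one]
      refine (wsum_mul _ _ _).trans ?_
      refine (mul_le_mul_right (wsum_add _ _ _) _).trans ?_
      rw [wsum_X, wsum_X, wsum_C, enorm_eq_nnnorm]
      exact_mod_cast h3
  | vertical =>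
    refine ⟨min 1 r, lt_min one_pos hr, fun i => ?_⟩
    have h1 : min 1 r ≤ 1 := min_le_left _ _
    have h2 : min 1 r ≤ r := min_le_right _ _
    have h3 : min 1 r * min 1 r ≤ r := (mul_le_of_le_one_left (by positivity) h1).trans h2
    fin_cases i
    · simp only [chart, Fin.zero_eta, Matrix.cons_val_zero]
      refine (wsum_mul _ _ _).trans ?_
      rw [wsum_X, wsum_X]
      exact_mod_cast h3
    · simp only [chart, Fin.mk_one, Matrix.cons_val_one, Matrix.cons_val_fin_one, wsum_X]
      exact_mod_cast h2

theorem isConvergent_subst_chart (d : Direction) {f : MvPowerSeries (Fin 2) ℂ}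
    (hf : IsConvergent f) : IsConvergent (MvPowerSeries.subst (chart d) f) := by
  rw [isConvergent_iff] at *
  obtain ⟨r, hr, hf⟩ := hf
  obtain ⟨s, hs, hle⟩ := wsum_chart_le d r hr
  refine ⟨s, hs, ne_top_of_le_ne_top hf ?_⟩
  have hmon : ∀ n : Fin 2 →₀ ℕ, wsum s (n.prod fun i k => chart d i ^ k) ≤
      (r : ℝ≥0∞) ^ n.degree := by
    intro n
    rw [Finsupp.prod_fintype _ _ (by simp), Fin.prod_univ_two, Finsupp.degree_eq_sum,
      Fin.sum_univ_two, pow_add]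
    refine (wsum_mul _ _ _).trans ?_
    gcongr
    · exact (wsum_pow _ _ _).trans (by gcongr; exact hle 0)
    · exact (wsum_pow _ _ _).trans (by gcongr; exact hle 1)
  calc wsum s (MvPowerSeries.subst (chart d) f)
      ≤ ∑' m : Fin 2 →₀ ℕ, ∑' n : Fin 2 →₀ ℕ, ‖MvPowerSeries.coeff n f‖ₑ *
        (‖MvPowerSeries.coeff m (n.prod fun i k => chart d i ^ k)‖ₑ * (s : ℝ≥0∞) ^ m.degree) := by
        unfold wsum
        refine ENNReal.tsum_le_tsum fun m => ?_
        have hfin := MvPowerSeries.coeff_subst_finite (hasSubst_chart d) f m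
        rw [MvPowerSeries.coeff_subst (hasSubst_chart d), finsum_eq_sum _ hfin]
        refine (mul_le_mul_left (enorm_sum_le _ _) _).trans ?_
        rw [Finset.sum_mul]
        refine le_trans (Finset.sum_le_sum fun n _ => ?_) (ENNReal.sum_le_tsum _)
        rw [smul_eq_mul, enorm_mul, mul_assoc]
    _ = ∑' n : Fin 2 →₀ ℕ, ‖MvPowerSeries.coeff n f‖ₑ *
        wsum s (n.prod fun i k => chart d i ^ k) := by
        rw [ENNReal.tsum_comm]
        refine tsum_congr fun n => ?_
        rw [ENNReal.tsum_mul_left]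
        rfl
    _ ≤ wsum r f := by
        refine ENNReal.tsum_le_tsum fun n => ?_
        gcongr
        exact hmon n

/-- The total transform `f ∘ π₁` at a point of the exceptional divisor. -/
def totalTransform (d : Direction) : HolGerm →ₐ[ℂ] HolGerm :=
  ((MvPowerSeries.substAlgHom (R := ℂ) (hasSubst_chart d)).comp convergentSeries.val).codRestrict
    convergentSeries fun f => by
      have h := isConvergent_subst_chart d f.2
      rwa [← MvPowerSeries.substAlgHom_apply (hasSubst_chart d)] at h

/-- The equation of the exceptional divisor in the chart centred at `d`. -/
def excEquation : Direction → HolGerm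
  | .slope _ => coord 0
  | .vertical => coord 1

/-- The strict transform of a curve `f = 0`: the total transform divided by the largest possible
power of the equation of the exceptional divisor. -/
def strictTransform (d : Direction) (f : HolGerm) : HolGerm :=
  Classical.epsilon fun g =>
    (∃ k : ℕ, totalTransform d f = excEquation d ^ k * g) ∧ ¬ excEquation d ∣ g

/-- The vector field `W` whose image by the blow-up `σ` is `ε X`, that is, `dσ(W) = ε · (X ∘ σ)`,
where `ε` is the equation of the exceptional divisor. -/
def pullbackField : Direction → VectorField → VectorField
  | .slope c, X =>
    (coord 0 * totalTransform (.slope c) X.1,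
      totalTransform (.slope c) X.2 - (coord 1 + algebraMap ℂ HolGerm c) *
        totalTransform (.slope c) X.1)
  | .vertical, X =>
    (totalTransform .vertical X.1 - coord 0 * totalTransform .vertical X.2,
      coord 1 * totalTransform .vertical X.2)

/-- The strict transform of the foliation given by `X`: it is given by the pullback of `X`, divided
by the largest possible power of the equation of the exceptional divisor. -/
def strictField (d : Direction) (X : VectorField) : VectorField :=
  Classical.epsilon fun Y =>
    (∃ k : ℕ, pullbackField d X = (excEquation d ^ k * Y.1, excEquation d ^ k * Y.2)) ∧
      ¬ (excEquation d ∣ Y.1 ∧ excEquation d ∣ Y.2)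

/-! ### Sequences of blow-ups

An infinitely near point of the origin is a list of directions `[d₁, …, dₖ]`: blow up the origin,
then the point `d₁` of the exceptional divisor, then the point `d₂` of the new component, etc.;
`dₖ` is a point of the last component, with the coordinates provided by `chart`. -/

/-- The strict transform of the curve `f = 0` at an infinitely near point. -/
def curveAt : List Direction → HolGerm → HolGerm
  | [], f => f
  | d :: q, f => curveAt q (strictTransform d f)

/-- The strict transform of the foliation given by `X` at an infinitely near point. -/
def fieldAt : List Direction → VectorField → VectorField
  | [], X => X
  | d :: q, X => fieldAt q (strictField d X)

/-- The components of the total exceptional divisor through `d`, if those through the blown-up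
point are `E`: the new component and the strict transforms of the old ones that contain `d`. -/
def excStep (d : Direction) (E : Set HolGerm) : Set HolGerm :=
  insert (excEquation d) {g | ¬ IsUnit g ∧ ∃ e ∈ E, g = strictTransform d e}

/-- Auxiliary recursion for `excAt`. -/
def excFrom : List Direction → Set HolGerm → Set HolGerm
  | [], E => E
  | d :: q, E => excFrom q (excStep d E)

/-- The equations of the irreducible components of the exceptional divisor through an infinitely
near point. -/
def excAt (q : List Direction) : Set HolGerm := excFrom q ∅

/-- A finite sequence of point blow-ups over the origin, given by the set `T` of its centres: with
each infinitely near point, `T` contains all the points that it is infinitely near to. -/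
def IsBlowUpSequence (T : Set (List Direction)) : Prop :=
  T.Finite ∧ ∀ q d, q ++ [d] ∈ T → q ∈ T

/-- `q` is a point of the fibre over the origin of the surface obtained by blowing up `T`. -/
def IsPointOver (T : Set (List Direction)) (q : List Direction) : Prop :=
  q ∉ T ∧ ∀ p, p <+: q → p ≠ q → p ∈ T

/-- At the point `q`, the strict transform of `f = 0` is empty or consists of one non-singular
branch, and in the latter case it meets at most one component of the exceptional divisor and is
transverse to it. -/
def IsDesingularizedAt (f : HolGerm) (q : List Direction) : Prop :=
  IsUnit (curveAt q f) ∨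
    (mult (curveAt q f) = 1 ∧ (excAt q).Subsingleton ∧
      ∀ D ∈ excAt q, AreTransverse (curveAt q f) D)

/-- `T` is a desingularization of the curve `f = 0`. -/
def IsDesingularization (f : HolGerm) (T : Set (List Direction)) : Prop :=
  IsBlowUpSequence T ∧ ∀ q, IsPointOver T q → IsDesingularizedAt f q

/-- `T` is the minimal desingularization of the curve `f = 0`. -/
def IsMinimalDesingularization (f : HolGerm) (T : Set (List Direction)) : Prop :=
  IsLeast {T' | IsDesingularization f T'} T

/-- `κ ≥ 1` at the point `q` where the strict transform of `γ = 0` by the desingularization `T`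
meets the exceptional divisor, for the component of the exceptional divisor to which `q` belongs. -/
def IsNonNull (X : VectorField) (T : Set (List Direction)) (γ : HolGerm) : Prop :=
  ∀ q, IsPointOver T q → ¬ IsUnit (curveAt q γ) →
    ∀ D ∈ excAt q, 1 ≤ kappa (fieldAt q X) (excAt q) D

/-- The curve with reduced equation `f = 0` is singular, invariant and weakly isolated for the
foliation given by `X`. In `f = g * v`, the curve `g = 0` is the important part and `v = 0` the
normal-crossings divisor. -/
def IsWeaklyIsolated (X : VectorField) (f : HolGerm) : Prop :=
  Squarefree f ∧ 2 ≤ mult f ∧ IsInvariant X f ∧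
    ∃ g v, f = g * v ∧ IsRelPrime g v ∧ IsNormalCrossings v ∧
      ∃ T, IsMinimalDesingularization f T ∧ ∀ γ, Irreducible γ → γ ∣ g → IsNonNull X T γ

/-- `h = 0` is a reduced equation of the union of the irreducible components of the total transform
of `f = 0` through the point `P` of the exceptional divisor that are invariant for the strict
transform of the foliation given by `X`. -/
def IsInvariantTotalTransform (X : VectorField) (f : HolGerm) (P : Direction) (h : HolGerm) :
    Prop :=
  Squarefree h ∧ ∀ γ, Irreducible γ →
    (γ ∣ h ↔ γ ∣ totalTransform P f ∧ IsInvariant (strictField P X) γ)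

end FolGerm

end

/-!
The reduced curve `h = 0` is the strict transform `f' = 0` of `f = 0` at `P`, together with the
exceptional divisor `e = 0` if the latter is invariant. Indeed, the components of `f'` are invariant
because `f` is, and `f'` is reduced because it has a desingularization. That `h` is then determined
by its irreducible factors uses that `ℂ{x, y}` is factorial, which follows from the Weierstrass
division theorem: it implies that the ideals `(a : b)` are principal.

Let `f = g v` with important part `g` and normal-crossings part `v`, and let `T` be the minimal
desingularization of `f`. At most one branch of `v` passes through `P`, and it is smooth and
transverse to `e = 0` (`IsNormalCrossings.strictTransform`). The points of `T` that are infinitely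
near to `P` give a desingularization of `h`, whence a minimal one `T'`, which is contained in it. At
a point `q` over `T'` that is on the strict transform of `g` but not on the strict transform of `e`,
the curve `f` is desingularized, so that by minimality `q` is not blown up by `T`, and the indices
of `f` and of `h` at `q` coincide (`one_le_kappa_of_strictTransform`). It remains to choose the
decomposition of `h` so that the important part only has such points.

* If `e = 0` is invariant, then it is added to the normal-crossings part. Since `e` is a component
  of `h`, which is desingularized by `T'`, its strict transform does not meet those of other
  components. If `P` is not blown up by `T`, then `f'` is smooth and transverse to `e = 0`, and all
  of `h` is a normal-crossings divisor.
* If `e = 0` is not invariant, then at most one point over `T'` is on the strict transforms of `e`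
  and `f'`, because `e = 0` is smooth. At this point, `f'` has one branch, which is smooth and
  transverse to the new component of the exceptional divisor. Blowing down step by step along
  `e = 0`, one sees that it comes from a smooth component of `f'` that is tangent to `e = 0`
  (`exists_mult_eq_one_of_dvd_curveAt`), and this component is added to the normal-crossings part.
-/

noncomputable section

namespace FolGerm

/-! ### Weierstrass division -/

/-- The weight `s ^ nᵢ * r ^ nⱼ` of a monomial for a bidisc with radii `s` and `r`. -/
def biWeight (i j : Fin 2) (s r : ℝ≥0) (n : Fin 2 →₀ ℕ) : ℝ≥0∞ :=
  (s : ℝ≥0∞) ^ n i * (r : ℝ≥0∞) ^ n j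

/-- The sum of the absolute values of the terms of `f` on a bidisc. -/
def biSum (i j : Fin 2) (s r : ℝ≥0) (f : MvPowerSeries (Fin 2) ℂ) : ℝ≥0∞ :=
  ∑' n : Fin 2 →₀ ℕ, ‖MvPowerSeries.coeff n f‖ₑ * biWeight i j s r n

theorem biWeight_add (i j : Fin 2) (s r : ℝ≥0) (m n : Fin 2 →₀ ℕ) :
    biWeight i j s r (m + n) = biWeight i j s r m * biWeight i j s r n := by
  simp only [biWeight, Finsupp.add_apply, pow_add]
  ring

theorem degree_eq_add {i j : Fin 2} (hij : i ≠ j) (n : Fin 2 →₀ ℕ) : n.degree = n i + n j := by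
  rw [Finsupp.degree_eq_sum, Fin.sum_univ_two]
  fin_cases i <;> fin_cases j <;> simp_all [add_comm]

theorem biSum_sub_le (i j : Fin 2) (s r : ℝ≥0) (f g : MvPowerSeries (Fin 2) ℂ) :
    biSum i j s r (f - g) ≤ biSum i j s r f + biSum i j s r g := by
  unfold biSum
  rw [← ENNReal.tsum_add]
  refine ENNReal.tsum_le_tsum fun n => ?_
  rw [← add_mul, map_sub]
  gcongr
  exact enorm_sub_le

theorem biSum_smul (i j : Fin 2) (s r : ℝ≥0) (a : ℂ) (f : MvPowerSeries (Fin 2) ℂ) :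
    biSum i j s r (a • f) = ‖a‖ₑ * biSum i j s r f := by
  unfold biSum
  rw [← ENNReal.tsum_mul_left]
  refine tsum_congr fun n => ?_
  rw [map_smul, smul_eq_mul, enorm_mul, mul_assoc]

theorem biSum_mul_le (i j : Fin 2) (s r : ℝ≥0) (f g : MvPowerSeries (Fin 2) ℂ) :
    biSum i j s r (f * g) ≤ biSum i j s r f * biSum i j s r g := by
  classical
  set F : (Fin 2 →₀ ℕ) × (Fin 2 →₀ ℕ) → ℝ≥0∞ := fun p =>
    (‖MvPowerSeries.coeff p.1 f‖ₑ * biWeight i j s r p.1) *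
      (‖MvPowerSeries.coeff p.2 g‖ₑ * biWeight i j s r p.2) with hF
  unfold biSum
  calc _ ≤ ∑' n : Fin 2 →₀ ℕ, ∑ p ∈ Finset.HasAntidiagonal.antidiagonal n, F p := by
        refine ENNReal.tsum_le_tsum fun n => ?_
        rw [MvPowerSeries.coeff_mul]
        refine (mul_le_mul_left (enorm_sum_le _ _) _).trans ?_
        rw [Finset.sum_mul]
        refine Finset.sum_le_sum fun p hp => ?_
        rw [← Finset.HasAntidiagonal.mem_antidiagonal.1 hp, enorm_mul, biWeight_add]
        exact le_of_eq (by rw [hF]; ring)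
    _ = ∑' q : Σ n : Fin 2 →₀ ℕ, Finset.HasAntidiagonal.antidiagonal n, F q.2.1 := by
        rw [ENNReal.tsum_sigma']
        refine tsum_congr fun n => ?_
        rw [tsum_fintype]
        exact (Finset.sum_coe_sort (Finset.HasAntidiagonal.antidiagonal n) F).symm
    _ = ∑' p : (Fin 2 →₀ ℕ) × (Fin 2 →₀ ℕ), F p :=
        Finset.HasAntidiagonal.sigmaAntidiagonalEquivProd.tsum_eq F
    _ = _ := by
        rw [ENNReal.tsum_prod', ← ENNReal.tsum_mul_right]
        refine tsum_congr fun n => ?_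
        rw [← ENNReal.tsum_mul_left]

theorem biSum_le_wsum {i j : Fin 2} (hij : i ≠ j) {s r ρ : ℝ≥0} (hs : s ≤ ρ) (hr : r ≤ ρ)
    (f : MvPowerSeries (Fin 2) ℂ) : biSum i j s r f ≤ wsum ρ f := by
  unfold biSum wsum biWeight
  refine ENNReal.tsum_le_tsum fun n => ?_
  rw [degree_eq_add hij, pow_add]
  gcongr

theorem wsum_le_biSum {i j : Fin 2} (hij : i ≠ j) {s r ρ : ℝ≥0} (hs : ρ ≤ s) (hr : ρ ≤ r)
    (f : MvPowerSeries (Fin 2) ℂ) : wsum ρ f ≤ biSum i j s r f := by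
  unfold biSum wsum biWeight
  refine ENNReal.tsum_le_tsum fun n => ?_
  rw [degree_eq_add hij, pow_add]
  gcongr

/-- The quotient of the division by `xᵢ ^ k`, where the remainder has degree less than `k` in `xᵢ`. -/
def shift (i : Fin 2) (k : ℕ) (f : MvPowerSeries (Fin 2) ℂ) : MvPowerSeries (Fin 2) ℂ :=
  fun m => MvPowerSeries.coeff (m + Finsupp.single i k) f

theorem coeff_shift (i : Fin 2) (k : ℕ) (f : MvPowerSeries (Fin 2) ℂ) (m : Fin 2 →₀ ℕ) :
    MvPowerSeries.coeff m (shift i k f) = MvPowerSeries.coeff (m + Finsupp.single i k) f := rfl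

theorem mul_biSum_shift_le {i j : Fin 2} (hij : i ≠ j) (s r : ℝ≥0) (k : ℕ)
    (f : MvPowerSeries (Fin 2) ℂ) :
    (s : ℝ≥0∞) ^ k * biSum i j s r (shift i k f) ≤ biSum i j s r f := by
  unfold biSum
  rw [← ENNReal.tsum_mul_left]
  refine le_trans (ENNReal.tsum_le_tsum fun n => ?_) (ENNReal.tsum_comp_le_tsum_of_injective
    (add_left_injective (Finsupp.single i k))
    (fun n => ‖MvPowerSeries.coeff n f‖ₑ * biWeight i j s r n))
  rw [coeff_shift, biWeight_add]
  refine le_of_eq ?_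
  simp [biWeight, hij.symm]
  ring

/-- A map of power series that is affine-bounded with slope `1/2` for the norm of a bidisc and that
contracts the filtration given by the grading `wt` has a fixed point of finite norm. -/
theorem exists_fixedPoint {i j : Fin 2} {s r : ℝ≥0}
    (Φ : MvPowerSeries (Fin 2) ℂ → MvPowerSeries (Fin 2) ℂ) (wt : (Fin 2 →₀ ℕ) → ℕ)
    {A : ℝ≥0∞} (hΦ : ∀ q, biSum i j s r (Φ q) ≤ A + 2⁻¹ * biSum i j s r q)
    (hwt : ∀ k p q, (∀ m, wt m < k → MvPowerSeries.coeff m p = MvPowerSeries.coeff m q) →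
      ∀ m, wt m < k + 1 → MvPowerSeries.coeff m (Φ p) = MvPowerSeries.coeff m (Φ q)) :
    ∃ q, Φ q = q ∧ biSum i j s r q ≤ 2 * A := by
  have hA : A + 2⁻¹ * (2 * A) = 2 * A := by
    rw [← mul_assoc, ENNReal.inv_mul_cancel (by simp) (by simp)]; ring
  set it : ℕ → MvPowerSeries (Fin 2) ℂ := fun k => Φ^[k] 0 with hit
  have hsucc : ∀ k, it (k + 1) = Φ (it k) := fun k => Function.iterate_succ_apply' Φ k 0
  have hbound : ∀ k, biSum i j s r (it k) ≤ 2 * A := by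
    intro k
    induction k with
    | zero => simp [hit, biSum]
    | succ k ih =>
      rw [hsucc]
      refine (hΦ _).trans ?_
      rw [← hA]
      gcongr
  have hstep : ∀ k m, wt m < k →
      MvPowerSeries.coeff m (it k) = MvPowerSeries.coeff m (it (k + 1)) := by
    intro k
    induction k with
    | zero => intro m hm; omega
    | succ k ih =>
      rw [hsucc k, hsucc (k + 1)]
      exact hwt k _ _ ih
  have hstab : ∀ k l, k ≤ l → ∀ m, wt m < k →
      MvPowerSeries.coeff m (it k) = MvPowerSeries.coeff m (it l) := by
    intro k l hkl
    induction l, hkl using Nat.le_induction with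
    | base => intros; rfl
    | succ l hl ih => intro m hm; rw [ih m hm, hstep l m (by omega)]
  set q : MvPowerSeries (Fin 2) ℂ := fun m => MvPowerSeries.coeff m (it (wt m + 1)) with hq
  have hcoeff : ∀ k m, wt m < k → MvPowerSeries.coeff m q = MvPowerSeries.coeff m (it k) :=
    fun k m hm => hstab _ _ hm m (Nat.lt_succ_self _)
  refine ⟨q, ?_, ?_⟩
  · ext m
    rw [hwt (wt m) q (it (wt m)) (fun m' hm' => hcoeff _ _ hm') m (Nat.lt_succ_self _), ← hsucc]
    rfl
  · unfold biSum
    rw [ENNReal.tsum_eq_iSup_sum]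
    refine iSup_le fun S => ?_
    refine le_trans (le_of_eq ?_) ((ENNReal.sum_le_tsum S).trans (hbound (S.sup wt + 1)))
    refine Finset.sum_congr rfl fun m hm => ?_
    rw [hcoeff (S.sup wt + 1) m (Nat.lt_succ_of_le (Finset.le_sup hm))]

/-- On a bidisc with radii `ρ σ` and `ρ σ ^ (n + 1)`, a series without monomials `xᵢ ^ k`, `k ≤ n`,
is small. -/
theorem biSum_le_of_coeff_eq_zero {i j : Fin 2} (hij : i ≠ j) {ρ σ : ℝ≥0} (hσ : σ ≤ 1) (n : ℕ)
    {b c : MvPowerSeries (Fin 2) ℂ}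
    (hbc : ∀ m, MvPowerSeries.coeff m b = MvPowerSeries.coeff m c ∨ MvPowerSeries.coeff m b = 0)
    (hb : ∀ m, m j = 0 → m i ≤ n → MvPowerSeries.coeff m b = 0) :
    biSum i j (ρ * σ) (ρ * σ ^ (n + 1)) b ≤ (σ : ℝ≥0∞) ^ (n + 1) * wsum ρ c := by
  unfold biSum wsum
  rw [← ENNReal.tsum_mul_left]
  refine ENNReal.tsum_le_tsum fun m => ?_
  by_cases h0 : MvPowerSeries.coeff m b = 0
  · simp [h0]
  rw [(hbc m).resolve_right h0]
  have h1 : σ ^ m i * (σ ^ (n + 1)) ^ m j ≤ σ ^ (n + 1) := by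
    rw [← pow_mul, ← pow_add]
    refine pow_le_pow_of_le_one (by positivity) hσ ?_
    rcases Nat.eq_zero_or_pos (m j) with h | h
    · have hni : n < m i := lt_of_not_ge fun h' => h0 (hb m h h')
      rw [h]
      omega
    · nlinarith
  have h2 : biWeight i j (ρ * σ) (ρ * σ ^ (n + 1)) m ≤
      (σ : ℝ≥0∞) ^ (n + 1) * (ρ : ℝ≥0∞) ^ m.degree := by
    unfold biWeight
    rw [degree_eq_add hij]
    have : (ρ * σ) ^ m i * (ρ * σ ^ (n + 1)) ^ m j ≤ σ ^ (n + 1) * ρ ^ (m i + m j) := by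
      calc _ = (σ ^ m i * (σ ^ (n + 1)) ^ m j) * ρ ^ (m i + m j) := by
            rw [mul_pow, mul_pow, pow_add]; ring
        _ ≤ _ := by gcongr
    exact_mod_cast this
  calc _ ≤ ‖MvPowerSeries.coeff m c‖ₑ * ((σ : ℝ≥0∞) ^ (n + 1) * (ρ : ℝ≥0∞) ^ m.degree) := by gcongr
    _ = _ := by ring

/-- Weierstrass division for convergent series: `c` is regular of order `n` in the variable `xᵢ`,
and the remainder is a polynomial of degree less than `n` in `xᵢ`. The quotient is a fixed point of
the map that sends `q` to the quotient of `F - (c - a xᵢ ^ n) q` by `a xᵢ ^ n`. -/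
theorem exists_weierstrass_quotient {i j : Fin 2} (hij : i ≠ j) (n : ℕ)
    {c F : MvPowerSeries (Fin 2) ℂ} (hc : IsConvergent c) (hF : IsConvergent F)
    (hlow : ∀ m : Fin 2 →₀ ℕ, m j = 0 → m i < n → MvPowerSeries.coeff m c = 0)
    (ha : MvPowerSeries.coeff (Finsupp.single i n) c ≠ 0) :
    ∃ q, IsConvergent q ∧ ∀ m : Fin 2 →₀ ℕ, n ≤ m i → MvPowerSeries.coeff m (F - c * q) = 0 := by
  classical
  rw [isConvergent_iff] at hc hF
  obtain ⟨ρ₁, hρ₁, hc⟩ := hc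
  obtain ⟨ρ₂, hρ₂, hF⟩ := hF
  set ρ := min ρ₁ ρ₂ with hρdef
  have hρ : 0 < ρ := lt_min hρ₁ hρ₂
  replace hc := ne_top_of_le_ne_top hc (wsum_mono (min_le_left ρ₁ ρ₂) c)
  replace hF := ne_top_of_le_ne_top hF (wsum_mono (min_le_right ρ₁ ρ₂) F)
  rw [← hρdef] at hc hF
  set a := MvPowerSeries.coeff (Finsupp.single i n) c with hadef
  set B := c - MvPowerSeries.monomial (Finsupp.single i n) a with hB
  have hcoeffB : ∀ m, m ≠ Finsupp.single i n →
      MvPowerSeries.coeff m B = MvPowerSeries.coeff m c := by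
    intro m hm
    rw [hB, map_sub, MvPowerSeries.coeff_monomial, if_neg hm, sub_zero]
  have hcoeffB' : MvPowerSeries.coeff (Finsupp.single i n) B = 0 := by
    rw [hB, map_sub, MvPowerSeries.coeff_monomial, if_pos rfl, sub_self]
  have hB0 : ∀ m, m j = 0 → m i ≤ n → MvPowerSeries.coeff m B = 0 := by
    intro m h1 h2
    by_cases hm : m = Finsupp.single i n
    · rw [hm, hcoeffB']
    · rw [hcoeffB m hm]
      refine hlow m h1 (lt_of_le_of_ne h2 fun h3 => hm ?_)
      ext k
      by_cases hk : k = i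
      · subst hk; simp [h3]
      · have : k = j := by fin_cases i <;> fin_cases j <;> fin_cases k <;> simp_all
        subst this
        simp [h1, hij]
  obtain ⟨M, hM⟩ := WithTop.ne_top_iff_exists.1 hc
  have ha' : 0 < ‖a‖₊ := by simpa using ha
  -- The radii `ρ σ` and `ρ σ ^ (n + 1)` make the norm of `B` at most half the one of `a xᵢ ^ n`.
  set σ : ℝ≥0 := min 1 (‖a‖₊ * ρ ^ n / (2 * (M + 1))) with hσdef
  have hσ : 0 < σ := lt_min one_pos (by positivity)
  have hσ1 : σ ≤ 1 := min_le_left _ _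
  have hσ2 : σ * (M * 2) ≤ ‖a‖₊ * ρ ^ n := by
    have : σ * (2 * (M + 1)) ≤ ‖a‖₊ * ρ ^ n := by
      rw [← le_div_iff₀ (by positivity)]; exact min_le_right _ _
    refine le_trans ?_ this
    rw [mul_comm M]
    gcongr
    simp
  set s := ρ * σ with hs
  set r := ρ * σ ^ (n + 1) with hr
  have hs0 : 0 < s := by positivity
  have hr0 : 0 < r := by positivity
  have hsρ : s ≤ ρ := mul_le_of_le_one_right (by positivity) hσ1
  have hrρ : r ≤ ρ := mul_le_of_le_one_right (by positivity) (pow_le_one₀ (by positivity) hσ1)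
  have hNB : biSum i j s r B ≤ (σ : ℝ≥0∞) ^ (n + 1) * M := by
    refine le_of_le_of_eq ?_ (congrArg _ hM.symm)
    refine biSum_le_of_coeff_eq_zero hij hσ1 n (fun m => ?_) hB0
    by_cases hm : m = Finsupp.single i n
    · right; rw [hm, hcoeffB']
    · left; exact hcoeffB m hm
  have hs0' : (s : ℝ≥0∞) ^ n ≠ 0 := by
    have : (s : ℝ≥0∞) ≠ 0 := by simpa using hs0.ne'
    positivity
  have hsT : (s : ℝ≥0∞) ^ n ≠ ⊤ := by simp
  have haE : ‖a‖ₑ ≠ 0 := by simpa using ha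
  have haT : ‖a‖ₑ ≠ ⊤ := by simp
  set κ : ℝ≥0∞ := ‖a⁻¹‖ₑ * ((s : ℝ≥0∞) ^ n)⁻¹ with hκ
  have hκtop : κ ≠ ⊤ := ENNReal.mul_ne_top (by simp) (by simp [hs0'])
  have hκB : κ * biSum i j s r B ≤ 2⁻¹ := by
    have h1 : ((‖a‖₊ * s ^ n : ℝ≥0) : ℝ≥0∞) * κ = 1 := by
      rw [hκ, enorm_inv ha]
      push_cast
      rw [← enorm_eq_nnnorm, mul_mul_mul_comm, ENNReal.mul_inv_cancel haE haT,
        ENNReal.mul_inv_cancel hs0' hsT, one_mul]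
    have h2 : biSum i j s r B ≤ ((‖a‖₊ * s ^ n : ℝ≥0) : ℝ≥0∞) * 2⁻¹ := by
      refine hNB.trans ?_
      rw [← div_eq_mul_inv, ENNReal.le_div_iff_mul_le (by simp) (by simp)]
      have : σ ^ (n + 1) * M * 2 ≤ ‖a‖₊ * s ^ n := by
        calc σ ^ (n + 1) * M * 2 = σ ^ n * (σ * (M * 2)) := by ring
          _ ≤ σ ^ n * (‖a‖₊ * ρ ^ n) := by gcongr
          _ = _ := by rw [hs]; ring
      exact_mod_cast this
    calc κ * biSum i j s r B ≤ κ * (((‖a‖₊ * s ^ n : ℝ≥0) : ℝ≥0∞) * 2⁻¹) := by gcongr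
      _ = (((‖a‖₊ * s ^ n : ℝ≥0) : ℝ≥0∞) * κ) * 2⁻¹ := by ring
      _ = 2⁻¹ := by rw [h1, one_mul]
  -- For this grading, `B` only has terms of weight more than `n`, while the division by `xᵢ ^ n`
  -- lowers the weight by `n`.
  set wt : (Fin 2 →₀ ℕ) → ℕ := fun m => (n + 1) * m j + m i with hwt
  have hwtadd : ∀ m m', wt (m + m') = wt m + wt m' := by
    intro m m'; simp only [hwt, Finsupp.add_apply]; ring
  have hwtn : wt (Finsupp.single i n) = n := by simp [hwt, hij]
  have hwtB : ∀ m, wt m < n + 1 → MvPowerSeries.coeff m B = 0 := by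
    intro m hm
    simp only [hwt] at hm
    have hmj : m j = 0 := by
      by_contra h
      have : n + 1 ≤ (n + 1) * m j := Nat.le_mul_of_pos_right _ (Nat.pos_of_ne_zero h)
      omega
    refine hB0 m hmj ?_
    rw [hmj] at hm
    omega
  obtain ⟨q, hq, hqN⟩ := exists_fixedPoint (i := i) (j := j) (s := s) (r := r)
    (fun q => a⁻¹ • shift i n (F - B * q)) wt (A := κ * biSum i j s r F)
    (by
      intro q
      have h1 : biSum i j s r (shift i n (F - B * q)) ≤
          ((s : ℝ≥0∞) ^ n)⁻¹ * biSum i j s r (F - B * q) := by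
        rw [mul_comm _ (biSum i j s r (F - B * q)), ← div_eq_mul_inv,
          ENNReal.le_div_iff_mul_le (Or.inl hs0') (Or.inl hsT), mul_comm]
        exact mul_biSum_shift_le hij s r n _
      rw [biSum_smul]
      calc _ ≤ ‖a⁻¹‖ₑ * (((s : ℝ≥0∞) ^ n)⁻¹ * (biSum i j s r F +
            biSum i j s r B * biSum i j s r q)) := by
            gcongr
            refine h1.trans ?_
            gcongr
            exact (biSum_sub_le _ _ _ _ _ _).trans (by gcongr; exact biSum_mul_le _ _ _ _ _ _)
        _ = κ * biSum i j s r F + (κ * biSum i j s r B) * biSum i j s r q := by rw [hκ]; ring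
        _ ≤ _ := by gcongr)
    (by
      intro k p q hpq m hm
      simp only [map_smul, coeff_shift, map_sub, MvPowerSeries.coeff_mul]
      congr 2
      refine Finset.sum_congr rfl fun u hu => ?_
      have hu' := congrArg wt (Finset.HasAntidiagonal.mem_antidiagonal.1 hu)
      rw [hwtadd, hwtadd, hwtn] at hu'
      by_cases h : wt u.1 < n + 1
      · rw [hwtB _ h, zero_mul, zero_mul]
      · rw [hpq u.2 (by omega)])
  refine ⟨q, ?_, fun m hm => ?_⟩
  · rw [isConvergent_iff]
    refine ⟨min s r, lt_min hs0 hr0, ne_top_of_le_ne_top ?_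
      ((wsum_le_biSum hij (min_le_left _ _) (min_le_right _ _) q).trans hqN)⟩
    exact ENNReal.mul_ne_top (by simp) (ENNReal.mul_ne_top hκtop
      (ne_top_of_le_ne_top hF (biSum_le_wsum hij hsρ hrρ F)))
  · obtain ⟨m', rfl⟩ : ∃ m', m = m' + Finsupp.single i n :=
      ⟨m - Finsupp.single i n, (tsub_add_cancel_of_le (Finsupp.single_le_iff.2 hm)).symm⟩
    have h1 : MvPowerSeries.coeff m' q =
        a⁻¹ * MvPowerSeries.coeff (m' + Finsupp.single i n) (F - B * q) := by
      conv_lhs => rw [← hq]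
      simp [coeff_shift]
    have h2 : c = B + MvPowerSeries.monomial (Finsupp.single i n) a := by rw [hB]; ring
    rw [h2, add_mul, ← sub_sub, map_sub, add_comm m', MvPowerSeries.coeff_add_monomial_mul, h1,
      mul_inv_cancel_left₀ ha, add_comm m', sub_self]

/-! ### The local ring of germs -/

/-- The value of a germ at the origin. -/
def value : HolGerm →+* ℂ := MvPowerSeries.constantCoeff.comp convergentSeries.subtype

theorem value_apply (f : HolGerm) : value f = MvPowerSeries.coeff 0 f.1 := rfl

theorem value_coord (i : Fin 2) : value (coord i) = 0 := MvPowerSeries.constantCoeff_X i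

theorem value_algebraMap (c : ℂ) : value (algebraMap ℂ HolGerm c) = c := by
  change MvPowerSeries.constantCoeff ((algebraMap ℂ HolGerm c : HolGerm) :
    MvPowerSeries (Fin 2) ℂ) = c
  rw [Subalgebra.coe_algebraMap, MvPowerSeries.algebraMap_apply]
  simp

theorem exists_weierstrass_division {i j : Fin 2} (hij : i ≠ j) (n : ℕ) (c F : HolGerm)
    (hlow : ∀ m : Fin 2 →₀ ℕ, m j = 0 → m i < n → MvPowerSeries.coeff m c.1 = 0)
    (ha : MvPowerSeries.coeff (Finsupp.single i n) c.1 ≠ 0) :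
    ∃ q r : HolGerm, F = c * q + r ∧
      ∀ m : Fin 2 →₀ ℕ, n ≤ m i → MvPowerSeries.coeff m r.1 = 0 := by
  obtain ⟨q, hq, h⟩ := exists_weierstrass_quotient hij n c.2 F.2 hlow ha
  obtain ⟨Q, hQ⟩ : ∃ Q : HolGerm, Q.1 = q := ⟨⟨q, hq⟩, rfl⟩
  refine ⟨Q, F - c * Q, (add_sub_cancel _ _).symm, fun m hm => ?_⟩
  rw [← h m hm, ← hQ]
  rfl

theorem isUnit_iff_value_ne_zero {f : HolGerm} : IsUnit f ↔ value f ≠ 0 := by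
  refine ⟨fun h => (h.map value).ne_zero, fun h => ?_⟩
  obtain ⟨q, r, h1, h2⟩ := exists_weierstrass_division (i := 0) (j := 1) (by decide) 0 f 1
    (fun m _ hm => absurd hm (Nat.not_lt_zero _)) (by simpa [value_apply] using h)
  have hr : r = 0 := Subtype.ext (MvPowerSeries.ext fun m => h2 m (Nat.zero_le _))
  rw [hr, add_zero] at h1
  exact IsUnit.of_mul_eq_one q h1.symm

theorem not_isUnit_iff_value_eq_zero {f : HolGerm} : ¬ IsUnit f ↔ value f = 0 := by
  rw [isUnit_iff_value_ne_zero, not_not]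

theorem coeff_coord_mul_of_eq_zero (i : Fin 2) (f : HolGerm) {m : Fin 2 →₀ ℕ} (hm : m i = 0) :
    MvPowerSeries.coeff m (coord i * f).1 = 0 :=
  MvPowerSeries.X_dvd_iff.1 (Dvd.intro f.1 rfl : MvPowerSeries.X i ∣ (coord i * f).1) m hm

theorem coeff_add_single_coord_mul (i : Fin 2) (f : HolGerm) (m : Fin 2 →₀ ℕ) :
    MvPowerSeries.coeff (m + Finsupp.single i 1) (coord i * f).1 = MvPowerSeries.coeff m f.1 := by
  rw [add_comm m]
  exact (MvPowerSeries.coeff_add_monomial_mul _ _ f.1 1).trans (one_mul _)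

theorem coeff_add_single_coord_pow_mul (i : Fin 2) (k : ℕ) (f : HolGerm) (m : Fin 2 →₀ ℕ) :
    MvPowerSeries.coeff (m + Finsupp.single i k) (coord i ^ k * f).1 =
      MvPowerSeries.coeff m f.1 := by
  induction k generalizing m with
  | zero => simp
  | succ k ih =>
    rw [pow_succ', mul_assoc, Finsupp.single_add, ← add_assoc, coeff_add_single_coord_mul, ih]

theorem eq_single_of_apply_eq_zero {i j : Fin 2} (hij : i ≠ j) {m : Fin 2 →₀ ℕ} (hm : m j = 0) :
    m = Finsupp.single i (m i) := by
  ext k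
  rcases eq_or_ne k i with rfl | hk
  · simp
  · obtain rfl : k = j := by
      fin_cases i <;> fin_cases j <;> fin_cases k <;> simp_all
    simp [hm, hij]

/-- Division with remainder by a coordinate. -/
theorem exists_eq_coord_mul_add {i j : Fin 2} (hij : i ≠ j) (f : HolGerm) :
    ∃ q r : HolGerm, f = coord i * q + r ∧
      ∀ m : Fin 2 →₀ ℕ, m i ≠ 0 → MvPowerSeries.coeff m r.1 = 0 := by
  obtain ⟨q, r, h1, h2⟩ := exists_weierstrass_division hij 1 (coord i) f
    (fun m _ hi => (by
      have := coeff_coord_mul_of_eq_zero i 1 (m := m) (by omega)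
      rwa [mul_one] at this)) (by simp [coord, MvPowerSeries.coeff_X])
  exact ⟨q, r, h1, fun m hm => h2 m (Nat.one_le_iff_ne_zero.2 hm)⟩

theorem coord_dvd_iff {i : Fin 2} {f : HolGerm} :
    coord i ∣ f ↔ ∀ m : Fin 2 →₀ ℕ, m i = 0 → MvPowerSeries.coeff m f.1 = 0 := by
  refine ⟨?_, fun h => ?_⟩
  · rintro ⟨g, rfl⟩ m hm
    exact coeff_coord_mul_of_eq_zero i g hm
  · obtain ⟨j, hij⟩ : ∃ j, i ≠ j := (exists_ne i).imp fun _ => Ne.symm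
    obtain ⟨q, r, h1, h2⟩ := exists_eq_coord_mul_add hij f
    have hr : r = 0 := by
      refine Subtype.ext (MvPowerSeries.ext fun m => ?_)
      by_cases hm : m i = 0
      · have h3 : r = f - coord i * q := by rw [h1]; ring
        have h4 := congrArg (fun g : HolGerm => MvPowerSeries.coeff m g.1) h3
        refine h4.trans ((map_sub (MvPowerSeries.coeff m) f.1 (coord i * q).1).trans ?_)
        rw [h m hm, coeff_coord_mul_of_eq_zero i q hm, sub_zero]
        rfl
      · exact h2 m hm
    exact ⟨q, by rw [h1, hr, add_zero]⟩

theorem exists_coeff_single_ne_zero {i j : Fin 2} (hij : i ≠ j) {f : HolGerm}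
    (hf : ¬ coord j ∣ f) : ∃ n, MvPowerSeries.coeff (Finsupp.single i n) f.1 ≠ 0 := by
  rw [coord_dvd_iff] at hf
  push Not at hf
  obtain ⟨m, hm, h⟩ := hf
  refine ⟨m i, ?_⟩
  rwa [← eq_single_of_apply_eq_zero hij hm]

theorem coord_ne_zero (i : Fin 2) : coord i ≠ 0 := by
  intro h
  have := coeff_add_single_coord_mul i 1 0
  rw [h, zero_mul] at this
  simp at this

theorem coord_prime (i : Fin 2) : Prime (coord i) := by
  have key : ∀ f : HolGerm, coord i ∣ f ↔ MvPowerSeries.weightedOrder (Pi.single i 1) f.1 ≠ 0 := by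
    intro f
    have hw : ∀ m : Fin 2 →₀ ℕ, Finsupp.weight (Pi.single i 1 : Fin 2 → ℕ) m = m i := by
      intro m
      rw [Finsupp.weight_apply, Finsupp.sum_fintype _ _ (by simp)]
      simp [Pi.single_apply]
    rw [coord_dvd_iff, ← Order.one_le_iff_ne_zero]
    refine ⟨fun h => ?_, fun h m hm => ?_⟩
    · refine MvPowerSeries.le_weightedOrder _ fun m hm => h m ?_
      rw [hw] at hm
      exact_mod_cast Order.lt_one_iff.1 hm
    · refine MvPowerSeries.coeff_eq_zero_of_lt_weightedOrder (Pi.single i 1) ?_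
      rw [hw, hm]
      exact lt_of_lt_of_le (by simp) h
  refine ⟨coord_ne_zero i, not_isUnit_iff_value_eq_zero.2 (value_coord i), fun f g h => ?_⟩
  by_contra hcon
  rw [not_or, key, key, not_not, not_not] at hcon
  rw [key] at h
  refine h ?_
  change MvPowerSeries.weightedOrder _ (f.1 * g.1) = 0
  rw [MvPowerSeries.weightedOrder_mul, hcon.1, hcon.2, add_zero]

theorem exists_eq_coord_mul_add_coord_mul {i j : Fin 2} (hij : i ≠ j) {f : HolGerm}
    (hf : value f = 0) : ∃ f₁ f₂, f = coord i * f₁ + coord j * f₂ := by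
  obtain ⟨q, r, h1, h2⟩ := exists_eq_coord_mul_add hij f
  have hr : value r = 0 := by
    rw [h1, map_add, map_mul, value_coord, zero_mul, zero_add] at hf
    exact hf
  obtain ⟨g, rfl⟩ : coord j ∣ r := by
    rw [coord_dvd_iff]
    intro m hm
    by_cases h : m i = 0
    · have : m = 0 := by rw [eq_single_of_apply_eq_zero hij hm, h, Finsupp.single_zero]
      rw [this]
      exact hr
    · exact h2 m h
  exact ⟨q, g, h1⟩

/-! ### Multiplicity -/

theorem mult_mul (f g : HolGerm) : mult (f * g) = mult f + mult g :=
  MvPowerSeries.order_mul f.1 g.1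

theorem mult_eq_top_iff {f : HolGerm} : mult f = ⊤ ↔ f = 0 := by
  rw [mult, MvPowerSeries.order_eq_top_iff]
  exact ⟨fun h => Subtype.ext h, fun h => by rw [h]; rfl⟩

theorem one_le_mult_iff {f : HolGerm} : 1 ≤ mult f ↔ ¬ IsUnit f := by
  rw [not_isUnit_iff_value_eq_zero]
  exact MvPowerSeries.one_le_order_iff_constCoeff_eq_zero

theorem mult_eq_zero_iff {f : HolGerm} : mult f = 0 ↔ IsUnit f := by
  rw [← not_iff_not, ← one_le_mult_iff, Order.one_le_iff_ne_zero]

theorem mult_le_of_dvd {f g : HolGerm} (h : f ∣ g) : mult f ≤ mult g := by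
  obtain ⟨k, rfl⟩ := h
  rw [mult_mul]
  exact le_self_add

theorem mult_coord (i : Fin 2) : mult (coord i) = 1 := by
  classical
  have := MvPowerSeries.order_monomial_of_ne_zero (d := Finsupp.single i 1) (one_ne_zero (α := ℂ))
  rw [Finsupp.degree_single] at this
  exact this

theorem ne_zero_of_mult_eq_one {f : HolGerm} (h : mult f = 1) : f ≠ 0 := by
  rintro rfl
  rw [mult_eq_top_iff.2 rfl] at h
  exact ENat.top_ne_one h

/-! ### Unique factorization -/

instance : WfDvdMonoid HolGerm :=
  ⟨Subrelation.wf (r := InvImage (· < ·) mult) (by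
      rintro a b ⟨ha, x, hx, rfl⟩
      change mult a < mult (a * x)
      rw [mult_mul]
      exact (ENat.lt_add_one_iff (by rwa [Ne, mult_eq_top_iff])).2 le_rfl |>.trans_le
        (by gcongr; exact one_le_mult_iff.2 hx))
    (InvImage.wf mult wellFounded_lt)⟩

theorem dvd_of_dvd_prime_pow_mul {p a z : HolGerm} (hp : Prime p) (ha : ¬ p ∣ a) (k : ℕ)
    (h : a ∣ p ^ k * z) : a ∣ z := by
  obtain ⟨w, hw⟩ := h
  obtain ⟨w', rfl⟩ := hp.pow_dvd_of_dvd_mul_left k ha (Dvd.intro _ hw)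
  exact ⟨w', mul_left_cancel₀ (pow_ne_zero k hp.ne_zero) (by rw [hw]; ring)⟩

/-- The ideal `(a : b)` is principal: an element of `(a : b)` of least order of contact with a
coordinate axis divides the others, because the remainder of the Weierstrass division by this
element is, up to a power of the equation of the axis, an element of smaller order of contact. -/
theorem exists_generator_colon {a : HolGerm} (ha : ¬ coord 0 ∣ a) (b : HolGerm) :
    ∃ c, a ∣ b * c ∧ ∀ z, a ∣ b * z → c ∣ z := by
  classical
  have h10 : (1 : Fin 2) ≠ 0 := by decide
  have hex : ∃ n, ∃ c : HolGerm, a ∣ b * c ∧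
      MvPowerSeries.coeff (Finsupp.single 1 n) c.1 ≠ 0 := by
    obtain ⟨n, hn⟩ := exists_coeff_single_ne_zero h10 ha
    exact ⟨n, a, dvd_mul_left a b, hn⟩
  obtain ⟨c, hc, hcn⟩ := Nat.find_spec hex
  set n := Nat.find hex with hn
  refine ⟨c, hc, fun z hz => ?_⟩
  obtain ⟨q, r, h1, h2⟩ := exists_weierstrass_division h10 n c z
    (fun m hm0 hm1 => by
      by_contra hne
      rw [eq_single_of_apply_eq_zero h10 hm0] at hne
      exact Nat.find_min hex hm1 ⟨c, hc, hne⟩) hcn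
  by_cases hr : r = 0
  · exact ⟨q, by rw [h1, hr, add_zero]⟩
  obtain ⟨k, r', hr', hrk⟩ := WfDvdMonoid.max_power_factor hr (coord_prime 0).irreducible
  obtain ⟨k', hk'⟩ := exists_coeff_single_ne_zero h10 hr'
  have hlt : k' < n := by
    by_contra hcon
    refine hk' ?_
    rw [← coeff_add_single_coord_pow_mul 0 k r', ← hrk]
    refine h2 _ ?_
    simpa using hcon
  refine absurd ⟨r', ?_, hk'⟩ (Nat.find_min hex hlt)
  refine dvd_of_dvd_prime_pow_mul (coord_prime 0) ha k ?_
  have h3 : coord 0 ^ k * (b * r') = b * z - b * c * q := by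
    rw [h1]
    linear_combination b * (-hrk)
  rw [h3]
  exact dvd_sub hz (hc.mul_right q)

theorem prime_of_irreducible {a : HolGerm} (ha : Irreducible a) : Prime a := by
  by_cases h0 : coord 0 ∣ a
  · exact ((coord_prime 0).irreducible.associated_of_dvd ha h0).prime (coord_prime 0)
  refine ⟨ha.ne_zero, ha.not_isUnit, fun b z hbz => ?_⟩
  obtain ⟨c, hc, hgen⟩ := exists_generator_colon h0 b
  obtain ⟨d, hd⟩ := hgen a (dvd_mul_left a b)
  rcases ha.isUnit_or_isUnit hd with hu | hu
  · exact Or.inl (hu.dvd_mul_right.1 hc)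
  · right
    rw [hd]
    exact hu.mul_right_dvd.2 (hgen z hbz)

instance : UniqueFactorizationMonoid HolGerm :=
  { (inferInstance : WfDvdMonoid HolGerm) with
    irreducible_iff_prime := ⟨prime_of_irreducible, Prime.irreducible⟩ }

/-! ### Linear parts -/

theorem partialDeriv_mul (i : Fin 2) (f g : HolGerm) :
    partialDeriv i (f * g) = f * partialDeriv i g + g * partialDeriv i f :=
  Subtype.ext (Derivation.leibniz (MvPowerSeries.pderiv ℂ i) f.1 g.1)

theorem partialDeriv_add (i : Fin 2) (f g : HolGerm) :
    partialDeriv i (f + g) = partialDeriv i f + partialDeriv i g :=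
  Subtype.ext (map_add (MvPowerSeries.pderiv ℂ i) f.1 g.1)

theorem partialDeriv_algebraMap (i : Fin 2) (c : ℂ) :
    partialDeriv i (algebraMap ℂ HolGerm c) = 0 :=
  Subtype.ext (Derivation.map_algebraMap (MvPowerSeries.pderiv ℂ i) c)

theorem partialDeriv_coord_self (i : Fin 2) : partialDeriv i (coord i) = 1 :=
  Subtype.ext MvPowerSeries.pderiv_X_self

theorem partialDeriv_coord_of_ne {i j : Fin 2} (h : j ≠ i) : partialDeriv i (coord j) = 0 :=
  Subtype.ext (MvPowerSeries.pderiv_X_of_ne h)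

/-- The coefficient of `xᵢ` in the linear part of a germ. -/
def linCoeff (i : Fin 2) (f : HolGerm) : ℂ := value (partialDeriv i f)

theorem linCoeff_mul (i : Fin 2) (f g : HolGerm) :
    linCoeff i (f * g) = value f * linCoeff i g + value g * linCoeff i f := by
  simp only [linCoeff, partialDeriv_mul, map_add, map_mul]

theorem linCoeff_add (i : Fin 2) (f g : HolGerm) :
    linCoeff i (f + g) = linCoeff i f + linCoeff i g := by
  simp only [linCoeff, partialDeriv_add, map_add]

theorem linCoeff_coord_self (i : Fin 2) : linCoeff i (coord i) = 1 := by
  rw [linCoeff, partialDeriv_coord_self, map_one]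

theorem linCoeff_coord_of_ne {i j : Fin 2} (h : j ≠ i) : linCoeff i (coord j) = 0 := by
  rw [linCoeff, partialDeriv_coord_of_ne h, map_zero]

theorem linCoeff_eq_coeff (i : Fin 2) (f : HolGerm) :
    linCoeff i f = MvPowerSeries.coeff (Finsupp.single i 1) f.1 := by
  change MvPowerSeries.coeff 0 (MvPowerSeries.pderiv ℂ i f.1) = _
  rw [MvPowerSeries.coeff_pderiv]
  simp

theorem jacobianAtZero_eq (f g : HolGerm) :
    jacobianAtZero f g = linCoeff 0 f * linCoeff 1 g - linCoeff 1 f * linCoeff 0 g := by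
  change value (_ - _) = _
  rw [map_sub, map_mul, map_mul]
  rfl

theorem mult_eq_one_of_linCoeff_ne_zero {f : HolGerm} (hf : value f = 0) {i : Fin 2}
    (h : linCoeff i f ≠ 0) : mult f = 1 := by
  refine le_antisymm ?_ (one_le_mult_iff.2 (not_isUnit_iff_value_eq_zero.2 hf))
  rw [linCoeff_eq_coeff] at h
  have := MvPowerSeries.order_le h
  rwa [Finsupp.degree_single] at this

theorem exists_linCoeff_ne_zero {f : HolGerm} (hf : mult f = 1) : ∃ i, linCoeff i f ≠ 0 := by
  have h1 : MvPowerSeries.order f.1 = (1 : ℕ) := hf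
  obtain ⟨⟨m, hm, hdeg⟩, -⟩ := MvPowerSeries.order_eq_nat.1 h1
  obtain ⟨i, rfl⟩ : ∃ i, m = Finsupp.single i 1 := by
    rw [Finsupp.degree_eq_sum, Fin.sum_univ_two] at hdeg
    rcases Nat.eq_zero_or_pos (m 0) with h | h
    · refine ⟨1, (eq_single_of_apply_eq_zero (i := 1) (by decide) h).trans ?_⟩
      rw [show m 1 = 1 by omega]
    · refine ⟨0, (eq_single_of_apply_eq_zero (i := 0) (j := 1) (by decide) (by omega)).trans ?_⟩
      rw [show m 0 = 1 by omega]
  exact ⟨i, by rwa [linCoeff_eq_coeff]⟩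

theorem value_eq_zero_of_mult_eq_one {f : HolGerm} (hf : mult f = 1) : value f = 0 :=
  not_isUnit_iff_value_eq_zero.1 (one_le_mult_iff.1 hf.ge)

theorem irreducible_of_mult_eq_one {f : HolGerm} (hf : mult f = 1) : Irreducible f := by
  refine ⟨one_le_mult_iff.1 hf.ge, ?_⟩
  rintro a b rfl
  by_contra! hcon
  rw [mult_mul] at hf
  have h := add_le_add (one_le_mult_iff.2 hcon.1) (one_le_mult_iff.2 hcon.2)
  rw [hf] at h
  exact absurd h (by decide)

theorem AreTransverse.mul_units_left {f g u : HolGerm} (h : AreTransverse f g) (hu : IsUnit u) :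
    AreTransverse (u * f) g := by
  obtain ⟨h1, h2, h3⟩ := h
  refine ⟨by rw [mult_mul, mult_eq_zero_iff.2 hu, zero_add, h1], h2, ?_⟩
  rw [jacobianAtZero_eq] at h3 ⊢
  rw [linCoeff_mul, linCoeff_mul, value_eq_zero_of_mult_eq_one h1]
  have hu' := isUnit_iff_value_ne_zero.1 hu
  intro h
  refine h3 (mul_left_cancel₀ hu' ?_)
  linear_combination h

theorem AreTransverse.symm {f g : HolGerm} (h : AreTransverse f g) : AreTransverse g f := by
  obtain ⟨h1, h2, h3⟩ := h
  refine ⟨h2, h1, fun h => h3 ?_⟩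
  rw [jacobianAtZero_eq] at h ⊢
  linear_combination -h

theorem not_areTransverse_self (f : HolGerm) : ¬ AreTransverse f f := by
  rintro ⟨-, -, h⟩
  exact h (by rw [jacobianAtZero_eq]; ring)

/-- Two tangent smooth curves are transverse to the same smooth curves. -/
theorem AreTransverse.of_not_areTransverse {e f g : HolGerm} (h : AreTransverse e g)
    (hf : mult f = 1) (hef : ¬ AreTransverse f e) : AreTransverse f g := by
  obtain ⟨h1, h2, h3⟩ := h
  refine ⟨hf, h2, fun h => ?_⟩
  have h4 : jacobianAtZero f e = 0 := by
    by_contra hne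
    exact hef ⟨hf, h1, hne⟩
  rw [jacobianAtZero_eq] at h h3 h4
  have h5 : linCoeff 0 f = 0 := by
    have : linCoeff 0 f * (linCoeff 0 e * linCoeff 1 g - linCoeff 1 e * linCoeff 0 g) = 0 := by
      linear_combination linCoeff 0 e * h - linCoeff 0 g * h4
    exact (mul_eq_zero.1 this).resolve_right h3
  have h6 : linCoeff 1 f = 0 := by
    have : linCoeff 1 f * (linCoeff 0 e * linCoeff 1 g - linCoeff 1 e * linCoeff 0 g) = 0 := by
      linear_combination linCoeff 1 e * h - linCoeff 1 g * h4
    exact (mul_eq_zero.1 this).resolve_right h3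
  obtain ⟨i, hi⟩ := exists_linCoeff_ne_zero hf
  fin_cases i
  · exact hi h5
  · exact hi h6

/-! ### The total transform -/

/-- The index of the coordinate that is an equation of the exceptional divisor. -/
def excVar : Direction → Fin 2
  | .slope _ => 0
  | .vertical => 1

/-- The index of the coordinate along the exceptional divisor. -/
def alongVar : Direction → Fin 2
  | .slope _ => 1
  | .vertical => 0

/-- The constant `c` such that the blow-up is `xⱼ ↦ xᵢ (xⱼ + c)` in the chart, where `xᵢ = 0` is the
exceptional divisor. -/
def center : Direction → ℂ
  | .slope c => c
  | .vertical => 0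

theorem alongVar_ne_excVar (d : Direction) : alongVar d ≠ excVar d := by
  cases d
  · exact one_ne_zero
  · exact zero_ne_one

theorem excVar_ne_alongVar (d : Direction) : excVar d ≠ alongVar d := (alongVar_ne_excVar d).symm

theorem excEquation_eq (d : Direction) : excEquation d = coord (excVar d) := by
  cases d <;> rfl

theorem excEquation_prime (d : Direction) : Prime (excEquation d) := by
  rw [excEquation_eq]
  exact coord_prime _

theorem mult_excEquation (d : Direction) : mult (excEquation d) = 1 := by
  rw [excEquation_eq, mult_coord]

theorem coe_totalTransform_coord (d : Direction) (i : Fin 2) :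
    (totalTransform d (coord i) : MvPowerSeries (Fin 2) ℂ) = chart d i := by
  change MvPowerSeries.substAlgHom (hasSubst_chart d) (MvPowerSeries.X i) = _
  rw [MvPowerSeries.substAlgHom_X]

theorem coe_algebraMap (c : ℂ) :
    ((algebraMap ℂ HolGerm c : HolGerm) : MvPowerSeries (Fin 2) ℂ) = MvPowerSeries.C c := by
  rw [Subalgebra.coe_algebraMap, MvPowerSeries.algebraMap_apply]
  simp

theorem totalTransform_coord_excVar (d : Direction) :
    totalTransform d (coord (excVar d)) = excEquation d := by
  refine Subtype.ext ?_
  rw [coe_totalTransform_coord]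
  cases d <;> rfl

theorem totalTransform_coord_alongVar (d : Direction) :
    totalTransform d (coord (alongVar d)) =
      excEquation d * (coord (alongVar d) + algebraMap ℂ HolGerm (center d)) := by
  refine Subtype.ext ?_
  rw [coe_totalTransform_coord, MulMemClass.coe_mul, AddMemClass.coe_add, coe_algebraMap]
  cases d with
  | slope c => rfl
  | vertical =>
    simp only [center, map_zero, add_zero]
    exact mul_comm _ _

theorem eq_algebraMap_add (i j : Fin 2) (hij : i ≠ j) (f : HolGerm) :
    ∃ f₁ f₂, f = algebraMap ℂ HolGerm (value f) + (coord i * f₁ + coord j * f₂) := by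
  obtain ⟨f₁, f₂, h⟩ := exists_eq_coord_mul_add_coord_mul hij
    (f := f - algebraMap ℂ HolGerm (value f)) (by rw [map_sub, value_algebraMap, sub_self])
  exact ⟨f₁, f₂, by rw [← h, add_sub_cancel]⟩

theorem excEquation_dvd_totalTransform_coord (d : Direction) (i : Fin 2) :
    excEquation d ∣ totalTransform d (coord i) := by
  rcases eq_or_ne i (excVar d) with rfl | h
  · rw [totalTransform_coord_excVar]
  · obtain rfl : i = alongVar d := by
      cases d <;> fin_cases i <;> simp_all [excVar, alongVar]
    rw [totalTransform_coord_alongVar]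
    exact dvd_mul_right _ _

theorem exists_totalTransform_eq_algebraMap_add (d : Direction) (f : HolGerm) :
    ∃ w, totalTransform d f = algebraMap ℂ HolGerm (value f) + excEquation d * w := by
  obtain ⟨f₁, f₂, h⟩ := eq_algebraMap_add 0 1 (by decide) f
  obtain ⟨a, ha⟩ := excEquation_dvd_totalTransform_coord d 0
  obtain ⟨b, hb⟩ := excEquation_dvd_totalTransform_coord d 1
  refine ⟨a * totalTransform d f₁ + b * totalTransform d f₂, ?_⟩
  conv_lhs => rw [h]
  rw [map_add, map_add, map_mul, map_mul, ha, hb, AlgHom.commutes]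
  ring

theorem value_totalTransform (d : Direction) (f : HolGerm) :
    value (totalTransform d f) = value f := by
  obtain ⟨w, hw⟩ := exists_totalTransform_eq_algebraMap_add d f
  rw [hw, map_add, map_mul, value_algebraMap, excEquation_eq, value_coord, zero_mul, add_zero]

theorem eq_zero_of_forall_pow_dvd {p f : HolGerm} (hp : ¬ IsUnit p) (h : ∀ k : ℕ, p ^ k ∣ f) :
    f = 0 := by
  have hpow : ∀ k : ℕ, (k : ℕ∞) ≤ mult (p ^ k) := by
    intro k
    induction k with
    | zero => simp
    | succ k ih =>
      rw [pow_succ, mult_mul, Nat.cast_succ]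
      exact add_le_add ih (one_le_mult_iff.2 hp)
  rw [← mult_eq_top_iff]
  exact ENat.eq_top_iff_forall_ge.2 fun k => (hpow k).trans (mult_le_of_dvd (h k))

/-- A derivation along the total transform that vanishes on the coordinates is zero, because its
values are divisible by all the powers of the equation of the exceptional divisor. -/
theorem eq_zero_of_leibniz (d : Direction) (D : HolGerm → HolGerm)
    (hadd : ∀ f g, D (f + g) = D f + D g) (hC : ∀ c, D (algebraMap ℂ HolGerm c) = 0)
    (hmul : ∀ f g, D (f * g) = totalTransform d f * D g + totalTransform d g * D f)
    (hcoord : ∀ i, D (coord i) = 0) (f : HolGerm) : D f = 0 := by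
  refine eq_zero_of_forall_pow_dvd (excEquation_prime d).not_isUnit fun k => ?_
  induction k generalizing f with
  | zero => simp
  | succ k ih =>
    obtain ⟨f₁, f₂, h⟩ := eq_algebraMap_add 0 1 (by decide) f
    rw [h, hadd, hC, hadd, hmul, hmul, hcoord, hcoord, mul_zero, mul_zero, add_zero, add_zero,
      zero_add, pow_succ']
    exact dvd_add (mul_dvd_mul (excEquation_dvd_totalTransform_coord d 0) (ih f₁))
      (mul_dvd_mul (excEquation_dvd_totalTransform_coord d 1) (ih f₂))

/-- The total transform does not change the germs that only depend on the coordinate that defines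
the exceptional divisor. -/
theorem totalTransform_eq_self (d : Direction) {r : HolGerm}
    (hr : ∀ m : Fin 2 →₀ ℕ, m (alongVar d) ≠ 0 → MvPowerSeries.coeff m r.1 = 0) :
    totalTransform d r = r := by
  refine sub_eq_zero.1 (eq_zero_of_forall_pow_dvd (excEquation_prime d).not_isUnit fun k => ?_)
  induction k generalizing r with
  | zero => simp
  | succ k ih =>
    obtain ⟨q, s, h1, h2⟩ := exists_eq_coord_mul_add (excVar_ne_alongVar d) r
    have hcoeff : ∀ m, MvPowerSeries.coeff m r.1 =
        MvPowerSeries.coeff m (coord (excVar d) * q).1 + MvPowerSeries.coeff m s.1 := by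
      intro m
      conv_lhs => rw [h1]
      exact map_add (MvPowerSeries.coeff m) _ _
    have hq : ∀ m : Fin 2 →₀ ℕ, m (alongVar d) ≠ 0 → MvPowerSeries.coeff m q.1 = 0 := by
      intro m hm
      have h3 := hcoeff (m + Finsupp.single (excVar d) 1)
      rw [coeff_add_single_coord_mul, h2 _ (by simp), add_zero, hr] at h3
      · exact h3.symm
      · simp [hm]
    have hs : s = algebraMap ℂ HolGerm (value s) := by
      refine Subtype.ext (MvPowerSeries.ext fun m => ?_)
      classical
      rw [coe_algebraMap, MvPowerSeries.coeff_C]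
      split_ifs with hm
      · rw [hm]; rfl
      by_cases hm1 : m (excVar d) = 0
      · have hm2 : m (alongVar d) ≠ 0 := by
          intro hm2
          refine hm ((eq_single_of_apply_eq_zero (excVar_ne_alongVar d) hm2).trans ?_)
          rw [hm1, Finsupp.single_zero]
        have h3 := hcoeff m
        rw [hr m hm2, coeff_coord_mul_of_eq_zero _ _ hm1, zero_add] at h3
        exact h3.symm
      · exact h2 m hm1
    have h4 : totalTransform d r - r = excEquation d * (totalTransform d q - q) := by
      rw [h1, map_add, map_mul, totalTransform_coord_excVar, hs, AlgHom.commutes, excEquation_eq]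
      ring
    rw [h4, pow_succ']
    exact mul_dvd_mul_left _ (ih hq)

/-! ### The strict transform of a curve -/

theorem exists_eq_coord_mul_add_coord_mul_le_mult {i j : Fin 2} (hij : i ≠ j) {f : HolGerm}
    (n : ℕ) (hf : ((n + 1 : ℕ) : ℕ∞) ≤ mult f) :
    ∃ f₁ f₂, f = coord i * f₁ + coord j * f₂ ∧ (n : ℕ∞) ≤ mult f₁ ∧ (n : ℕ∞) ≤ mult f₂ := by
  have hf0 : ∀ m : Fin 2 →₀ ℕ, m.degree < n + 1 → MvPowerSeries.coeff m f.1 = 0 :=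
    fun m hm => MvPowerSeries.coeff_of_lt_order (lt_of_lt_of_le (by exact_mod_cast hm) hf)
  obtain ⟨q, r, h1, h2⟩ := exists_eq_coord_mul_add hij f
  have hcoeff : ∀ m, MvPowerSeries.coeff m f.1 =
      MvPowerSeries.coeff m (coord i * q).1 + MvPowerSeries.coeff m r.1 := by
    intro m
    conv_lhs => rw [h1]
    exact map_add (MvPowerSeries.coeff m) _ _
  have hr : ∀ m : Fin 2 →₀ ℕ, m.degree < n + 1 → MvPowerSeries.coeff m r.1 = 0 := by
    intro m hm
    by_cases hmi : m i = 0
    · have h3 := hcoeff m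
      rw [hf0 m hm, coeff_coord_mul_of_eq_zero _ _ hmi, zero_add] at h3
      exact h3.symm
    · exact h2 m hmi
  obtain ⟨g, rfl⟩ : coord j ∣ r := by
    rw [coord_dvd_iff]
    intro m hm
    by_cases h : m i = 0
    · have : m = 0 := by rw [eq_single_of_apply_eq_zero hij hm, h, Finsupp.single_zero]
      exact hr m (by simp [this])
    · exact h2 m h
  refine ⟨q, g, h1, MvPowerSeries.nat_le_order fun m hm => ?_,
    MvPowerSeries.nat_le_order fun m hm => ?_⟩
  · have h3 := hcoeff (m + Finsupp.single i 1)
    rw [coeff_add_single_coord_mul, h2 _ (by simp), add_zero, hf0] at h3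
    · exact h3.symm
    · simpa using hm
  · rw [← coeff_add_single_coord_mul j]
    exact hr _ (by simpa using hm)

/-- A germ of multiplicity at least `n` is a form of degree `n` in the coordinates with coefficients
in the ring of germs. -/
theorem exists_eq_sum_coord_pow (n : ℕ) (f : HolGerm) (hf : (n : ℕ∞) ≤ mult f) :
    ∃ φ : ℕ → HolGerm,
      f = ∑ b ∈ Finset.range (n + 1), coord 0 ^ (n - b) * coord 1 ^ b * φ b := by
  induction n generalizing f with
  | zero => exact ⟨fun _ => f, by simp⟩
  | succ n ih =>
    obtain ⟨f₁, f₂, h, h1, h2⟩ := exists_eq_coord_mul_add_coord_mul_le_mult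
      (i := 0) (j := 1) (by decide) n hf
    obtain ⟨φ, hφ⟩ := ih f₁ h1
    obtain ⟨ψ, hψ⟩ := ih f₂ h2
    refine ⟨fun b => (if b ≤ n then φ b else 0) + (if b = 0 then 0 else ψ (b - 1)), ?_⟩
    simp only [mul_add, Finset.sum_add_distrib]
    rw [Finset.sum_range_succ, Finset.sum_range_succ' _ (n + 1), if_neg (by omega), if_pos rfl,
      mul_zero, add_zero, mul_zero, add_zero]
    conv_lhs => rw [h, hφ, hψ, Finset.mul_sum, Finset.mul_sum]
    congr 1
    · refine Finset.sum_congr rfl fun b hb => ?_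
      have hb' : b ≤ n := Nat.lt_succ_iff.1 (Finset.mem_range.1 hb)
      rw [if_pos hb', Nat.succ_sub hb', pow_succ]
      ring
    · refine Finset.sum_congr rfl fun b hb => ?_
      rw [if_neg (by omega), Nat.add_sub_add_right, Nat.add_sub_cancel, pow_succ (coord 1)]
      ring

/-- The restriction to the exceptional divisor of the strict transform of the curve whose tangent
cone has the coefficients `v`, as a polynomial in the coordinate `y + c` or `x` of the line. -/
def tangentPoly (v : ℕ → ℂ) (n : ℕ) : Direction → Polynomial ℂ
  | .slope _ => ∑ b ∈ Finset.range (n + 1), Polynomial.C (v b) * Polynomial.X ^ b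
  | .vertical => ∑ b ∈ Finset.range (n + 1), Polynomial.C (v b) * Polynomial.X ^ (n - b)

theorem tangentPoly_ne_zero {v : ℕ → ℂ} {n b : ℕ} (hb : b ≤ n) (hv : v b ≠ 0) (d : Direction) :
    tangentPoly v n d ≠ 0 := by
  intro h
  cases d with
  | slope c =>
    have := congrArg (Polynomial.coeff · b) h
    simp only [tangentPoly, Polynomial.finsetSum_coeff, Polynomial.coeff_C_mul_X_pow,
      Polynomial.coeff_zero, Finset.sum_ite_eq, Finset.mem_range] at this
    rw [if_pos (by omega)] at this
    exact hv this
  | vertical =>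
    have := congrArg (Polynomial.coeff · (n - b)) h
    simp only [tangentPoly, Polynomial.finsetSum_coeff, Polynomial.coeff_C_mul_X_pow,
      Polynomial.coeff_zero] at this
    rw [Finset.sum_eq_single b, if_pos rfl] at this
    · exact hv this
    · intro b' hb' hne
      have := Finset.mem_range.1 hb'
      rw [if_neg (by omega)]
    · intro hb'
      exact absurd (Finset.mem_range.2 (by omega)) hb'

theorem not_coord_dvd_aeval {i j : Fin 2} (hij : i ≠ j) (c : ℂ) {p : Polynomial ℂ} (hp : p ≠ 0) :
    ¬ coord i ∣ Polynomial.aeval (coord j + algebraMap ℂ HolGerm c) p := by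
  intro h
  rw [(IsAlgClosed.splits p).eq_prod_roots, map_mul, Polynomial.aeval_C] at h
  rcases (coord_prime i).dvd_or_dvd h with h | h
  · refine (coord_prime i).not_isUnit (isUnit_of_dvd_unit h ?_)
    exact (IsUnit.mk0 _ (Polynomial.leadingCoeff_ne_zero.2 hp)).map _
  · rw [map_multiset_prod, Multiset.map_map] at h
    obtain ⟨q, hq, hdvd⟩ := (coord_prime i).exists_mem_multiset_dvd h
    obtain ⟨a, -, rfl⟩ := Multiset.mem_map.1 hq
    obtain ⟨w, hw⟩ := hdvd
    have := congrArg (linCoeff j) hw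
    rw [linCoeff_mul, value_coord, linCoeff_coord_of_ne hij] at this
    simp only [Function.comp_apply, map_sub, Polynomial.aeval_X, Polynomial.aeval_C] at this
    rw [add_sub_assoc, ← map_sub, linCoeff_add, linCoeff_coord_self, linCoeff,
      partialDeriv_algebraMap] at this
    simp at this

/-- The strict transforms of a curve of multiplicity `n` by the blow-up of the origin meet the
exceptional divisor in the zeros of the leading form. -/
theorem exists_tangentPoly {f : HolGerm} {n : ℕ} (hf : mult f = n) :
    ∃ v : ℕ → ℂ, (∃ b ≤ n, v b ≠ 0) ∧ ∀ d, ∃ g, totalTransform d f = excEquation d ^ n * g ∧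
      excEquation d ∣ g - Polynomial.aeval (coord (alongVar d) + algebraMap ℂ HolGerm (center d))
        (tangentPoly v n d) := by
  obtain ⟨φ, hφ⟩ := exists_eq_sum_coord_pow n f hf.ge
  refine ⟨fun b => value (φ b), ?_, fun d => ?_⟩
  · by_contra! hcon
    have hle : ((n + 1 : ℕ) : ℕ∞) ≤ mult f := by
      have key : ∀ s ⊆ Finset.range (n + 1), ((n + 1 : ℕ) : ℕ∞) ≤
          mult (∑ b ∈ s, coord 0 ^ (n - b) * coord 1 ^ b * φ b) := by
        intro s
        induction s using Finset.induction_on with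
        | empty => intro _; rw [Finset.sum_empty, mult_eq_top_iff.2 rfl]; exact le_top
        | insert b s hb ih =>
          intro hs
          rw [Finset.sum_insert hb]
          refine le_trans (le_min ?_ (ih ((Finset.subset_insert b s).trans hs)))
            MvPowerSeries.min_order_le_add
          have hbn : b ≤ n :=
            Nat.lt_succ_iff.1 (Finset.mem_range.1 (hs (Finset.mem_insert_self b s)))
          have hpow : ∀ (i : Fin 2) (k : ℕ), mult (coord i ^ k) = k := by
            intro i k
            induction k with
            | zero => simpa using mult_eq_zero_iff.2 isUnit_one
            | succ k ih => rw [pow_succ, mult_mul, ih, mult_coord, Nat.cast_succ]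
          change _ ≤ mult _
          rw [mult_mul, mult_mul, hpow, hpow, ← Nat.cast_add, Nat.sub_add_cancel hbn, Nat.cast_succ]
          gcongr
          exact one_le_mult_iff.2 (not_isUnit_iff_value_eq_zero.2 (hcon b hbn))
      rw [hφ]
      exact key _ subset_rfl
    rw [hf] at hle
    have := ENat.natCast_le_natCast.1 hle
    omega
  · choose w hw using fun b => exists_totalTransform_eq_algebraMap_add d (φ b)
    have hx := totalTransform_coord_excVar d
    have hy := totalTransform_coord_alongVar d
    cases d with
    | slope c =>
      simp only [excVar, alongVar, center, tangentPoly] at hx hy ⊢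
      refine ⟨∑ b ∈ Finset.range (n + 1), (coord 1 + algebraMap ℂ HolGerm c) ^ b *
        totalTransform (.slope c) (φ b), ?_, ?_⟩
      · conv_lhs => rw [hφ]
        rw [map_sum, Finset.mul_sum]
        refine Finset.sum_congr rfl fun b hb => ?_
        have hbn : b ≤ n := Nat.lt_succ_iff.1 (Finset.mem_range.1 hb)
        rw [map_mul, map_mul, map_pow, map_pow, hx, hy, mul_pow, ← mul_assoc, ← pow_add,
          Nat.sub_add_cancel hbn, mul_assoc]
      · rw [map_sum, ← Finset.sum_sub_distrib]
        refine Finset.dvd_sum fun b _ => ⟨(coord 1 + algebraMap ℂ HolGerm c) ^ b * w b, ?_⟩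
        rw [hw, map_mul, map_pow, Polynomial.aeval_C, Polynomial.aeval_X]
        ring
    | vertical =>
      simp only [excVar, alongVar, center, tangentPoly, map_zero, add_zero] at hx hy ⊢
      refine ⟨∑ b ∈ Finset.range (n + 1), coord 0 ^ (n - b) *
        totalTransform .vertical (φ b), ?_, ?_⟩
      · conv_lhs => rw [hφ]
        rw [map_sum, Finset.mul_sum]
        refine Finset.sum_congr rfl fun b hb => ?_
        have hbn : b ≤ n := Nat.lt_succ_iff.1 (Finset.mem_range.1 hb)
        rw [map_mul, map_mul, map_pow, map_pow, hx, hy, mul_pow]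
        conv_rhs => rw [← Nat.sub_add_cancel hbn, pow_add, Nat.add_sub_cancel]
        ring
      · rw [map_sum, ← Finset.sum_sub_distrib]
        refine Finset.dvd_sum fun b _ => ⟨coord 0 ^ (n - b) * w b, ?_⟩
        rw [hw, map_mul, map_pow, Polynomial.aeval_C, Polynomial.aeval_X]
        ring

theorem strictTransform_eq {d : Direction} {f g : HolGerm} {k : ℕ}
    (h : totalTransform d f = excEquation d ^ k * g) (hg : ¬ excEquation d ∣ g) :
    strictTransform d f = g := by
  have hex : ∃ g, (∃ k : ℕ, totalTransform d f = excEquation d ^ k * g) ∧ ¬ excEquation d ∣ g :=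
    ⟨g, ⟨k, h⟩, hg⟩
  have hspec : (∃ k : ℕ, totalTransform d f = excEquation d ^ k * strictTransform d f) ∧
      ¬ excEquation d ∣ strictTransform d f := Classical.epsilon_spec hex
  obtain ⟨⟨l, hl⟩, hs⟩ := hspec
  rw [h] at hl
  have hne := (excEquation_prime d).ne_zero
  rcases lt_trichotomy k l with hkl | rfl | hkl
  · refine absurd ?_ hg
    rw [← Nat.sub_add_cancel hkl.le, pow_add, mul_comm (_ ^ (l - k)), mul_assoc] at hl
    rw [mul_left_cancel₀ (pow_ne_zero k hne) hl]
    exact (dvd_pow_self _ (by omega)).mul_right _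
  · exact (mul_left_cancel₀ (pow_ne_zero k hne) hl).symm
  · refine absurd ?_ hs
    rw [← Nat.sub_add_cancel hkl.le, pow_add, mul_comm (_ ^ (k - l)), mul_assoc] at hl
    rw [← mul_left_cancel₀ (pow_ne_zero l hne) hl]
    exact (dvd_pow_self _ (by omega)).mul_right _

theorem strictTransform_spec (d : Direction) {f : HolGerm} (hf : f ≠ 0) :
    ∃ n : ℕ, mult f = n ∧ totalTransform d f = excEquation d ^ n * strictTransform d f ∧
      ¬ excEquation d ∣ strictTransform d f := by
  obtain ⟨n, hn⟩ := ENat.ne_top_iff_exists.1 (mt mult_eq_top_iff.1 hf)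
  obtain ⟨v, ⟨b, hb, hv⟩, h⟩ := exists_tangentPoly hn.symm
  obtain ⟨g, hg1, hg2⟩ := h d
  have hg3 : ¬ excEquation d ∣ g := by
    intro hdvd
    rw [dvd_sub_right hdvd, excEquation_eq] at hg2
    exact not_coord_dvd_aeval (excVar_ne_alongVar d) _ (tangentPoly_ne_zero hb hv d) hg2
  rw [strictTransform_eq hg1 hg3]
  exact ⟨n, hn.symm, hg1, hg3⟩

theorem not_excEquation_dvd_strictTransform (d : Direction) {f : HolGerm} (hf : f ≠ 0) :
    ¬ excEquation d ∣ strictTransform d f :=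
  (strictTransform_spec d hf).choose_spec.2.2

theorem strictTransform_ne_zero (d : Direction) {f : HolGerm} (hf : f ≠ 0) :
    strictTransform d f ≠ 0 := by
  intro h
  refine not_excEquation_dvd_strictTransform d hf ?_
  rw [h]
  exact dvd_zero _

theorem totalTransform_ne_zero (d : Direction) {f : HolGerm} (hf : f ≠ 0) :
    totalTransform d f ≠ 0 := by
  obtain ⟨n, -, h, -⟩ := strictTransform_spec d hf
  rw [h]
  exact mul_ne_zero (pow_ne_zero _ (excEquation_prime d).ne_zero) (strictTransform_ne_zero d hf)

theorem strictTransform_mul (d : Direction) {f g : HolGerm} (hf : f ≠ 0) (hg : g ≠ 0) :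
    strictTransform d (f * g) = strictTransform d f * strictTransform d g := by
  obtain ⟨n, -, hn, hn'⟩ := strictTransform_spec d hf
  obtain ⟨m, -, hm, hm'⟩ := strictTransform_spec d hg
  refine strictTransform_eq (k := n + m) ?_ fun h =>
    ((excEquation_prime d).dvd_or_dvd h).elim hn' hm'
  conv_lhs => rw [map_mul, hn, hm]
  ring

theorem isUnit_strictTransform (d : Direction) {f : HolGerm} (hf : IsUnit f) :
    IsUnit (strictTransform d f) := by
  obtain ⟨n, -, h, -⟩ := strictTransform_spec d hf.ne_zero
  have := hf.map (totalTransform d)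
  rw [h] at this
  exact isUnit_of_mul_isUnit_right this

/-- The tangent cone of a curve has a zero. -/
theorem exists_not_isUnit_strictTransform {f : HolGerm} (hf : f ≠ 0) (hu : ¬ IsUnit f) :
    ∃ d, ¬ IsUnit (strictTransform d f) := by
  obtain ⟨n, hn⟩ := ENat.ne_top_iff_exists.1 (mt mult_eq_top_iff.1 hf)
  obtain ⟨v, ⟨b, hb, hv⟩, h⟩ := exists_tangentPoly hn.symm
  have key : ∀ d, (tangentPoly v n d).eval (center d) = 0 → ¬ IsUnit (strictTransform d f) := by
    intro d hd
    obtain ⟨g, hg1, w, hw⟩ := h d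
    obtain ⟨n', hn', hs, -⟩ := strictTransform_spec d hf
    rw [← hn, ENat.natCast_inj] at hn'
    subst hn'
    rw [hg1] at hs
    rw [← mul_left_cancel₀ (pow_ne_zero n (excEquation_prime d).ne_zero) hs,
      not_isUnit_iff_value_eq_zero, eq_add_of_sub_eq hw, map_add, map_mul, excEquation_eq,
      value_coord, zero_mul, zero_add, Polynomial.aeval_def, Polynomial.hom_eval₂]
    have h1 : value.comp (algebraMap ℂ HolGerm) = RingHom.id ℂ :=
      RingHom.ext fun c => value_algebraMap c
    rw [h1, map_add, value_coord, value_algebraMap, zero_add]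
    exact hd
  have hn1 : n ≠ 0 := by
    rintro rfl
    exact hu (mult_eq_zero_iff.1 hn.symm)
  by_cases hvn : v n = 0
  · refine ⟨.vertical, key _ ?_⟩
    simp only [tangentPoly, center, Polynomial.eval_finsetSum]
    refine Finset.sum_eq_zero fun b hb => ?_
    rcases eq_or_ne b n with rfl | hne
    · simp [hvn]
    · have := Finset.mem_range.1 hb
      simp [show n - b ≠ 0 by omega]
  · obtain ⟨c, hc⟩ := IsAlgClosed.exists_root (tangentPoly v n (.slope 0)) (by
      have hcoeff : (tangentPoly v n (.slope 0)).coeff n = v n := by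
        simp [tangentPoly, Polynomial.finsetSum_coeff]
      intro hdeg
      have := Polynomial.coeff_eq_zero_of_degree_lt (p := tangentPoly v n (.slope 0)) (n := n)
        (by rw [hdeg]; exact_mod_cast Nat.pos_of_ne_zero hn1)
      exact hvn (hcoeff.symm.trans this))
    exact ⟨.slope c, key _ hc⟩

/-! ### Smooth curves and blow-ups -/

theorem areTransverse_excEquation_iff {d : Direction} {f : HolGerm} :
    AreTransverse f (excEquation d) ↔ value f = 0 ∧ linCoeff (alongVar d) f ≠ 0 := by
  have hjac : jacobianAtZero f (excEquation d) ≠ 0 ↔ linCoeff (alongVar d) f ≠ 0 := by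
    rw [jacobianAtZero_eq, excEquation_eq]
    cases d
    · simp [excVar, alongVar, linCoeff_coord_self, linCoeff_coord_of_ne]
    · simp [excVar, alongVar, linCoeff_coord_self, linCoeff_coord_of_ne]
  refine ⟨fun h => ⟨value_eq_zero_of_mult_eq_one h.1, hjac.1 h.2.2⟩, fun h =>
    ⟨mult_eq_one_of_linCoeff_ne_zero h.1 h.2, mult_excEquation d, hjac.2 h.2⟩⟩

theorem linCoeff_alongVar_excEquation_mul (d : Direction) (w : HolGerm) :
    linCoeff (alongVar d) (excEquation d * w) = 0 := by
  rw [linCoeff_mul, excEquation_eq, value_coord, linCoeff_coord_of_ne (excVar_ne_alongVar d)]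
  ring

theorem linCoeff_algebraMap (i : Fin 2) (c : ℂ) : linCoeff i (algebraMap ℂ HolGerm c) = 0 := by
  rw [linCoeff, partialDeriv_algebraMap, map_zero]

theorem linCoeff_alongVar_totalTransform (d : Direction) (f : HolGerm) :
    linCoeff (alongVar d) (totalTransform d f) = 0 := by
  obtain ⟨w, hw⟩ := exists_totalTransform_eq_algebraMap_add d f
  rw [hw, linCoeff_add, linCoeff_algebraMap, linCoeff_alongVar_excEquation_mul, add_zero]

/-- The linear part of the strict transform of a smooth curve. -/
theorem strictTransform_of_mult_eq_one (d : Direction) {f : HolGerm} (hf : mult f = 1) :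
    value (strictTransform d f) = linCoeff (excVar d) f + center d * linCoeff (alongVar d) f ∧
      linCoeff (alongVar d) (strictTransform d f) = linCoeff (alongVar d) f := by
  have hij := excVar_ne_alongVar d
  obtain ⟨n, hn, hs, -⟩ := strictTransform_spec d (ne_zero_of_mult_eq_one hf)
  obtain rfl : n = 1 := by
    rw [hf] at hn
    exact_mod_cast hn.symm
  obtain ⟨f₁, f₂, h⟩ := exists_eq_coord_mul_add_coord_mul hij (value_eq_zero_of_mult_eq_one hf)
  have h1 : linCoeff (excVar d) f = value f₁ := by
    rw [h, linCoeff_add, linCoeff_mul, linCoeff_mul, value_coord, value_coord,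
      linCoeff_coord_self, linCoeff_coord_of_ne hij.symm]
    ring
  have h2 : linCoeff (alongVar d) f = value f₂ := by
    rw [h, linCoeff_add, linCoeff_mul, linCoeff_mul, value_coord, value_coord,
      linCoeff_coord_self, linCoeff_coord_of_ne hij]
    ring
  have h3 : totalTransform d f = excEquation d * (totalTransform d f₁ +
      (coord (alongVar d) + algebraMap ℂ HolGerm (center d)) * totalTransform d f₂) := by
    conv_lhs => rw [h]
    rw [map_add, map_mul, map_mul, totalTransform_coord_excVar, totalTransform_coord_alongVar]
    ring
  rw [h3, pow_one] at hs
  rw [← mul_left_cancel₀ (excEquation_prime d).ne_zero hs, h1, h2]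
  constructor
  · rw [map_add, map_mul, map_add, value_totalTransform, value_totalTransform, value_coord,
      value_algebraMap, zero_add]
  · rw [linCoeff_add, linCoeff_mul, linCoeff_add, linCoeff_alongVar_totalTransform,
      linCoeff_alongVar_totalTransform, linCoeff_coord_self, linCoeff_algebraMap,
      value_totalTransform]
    ring

theorem linCoeff_alongVar_ne_zero {d : Direction} {f : HolGerm} (hf : mult f = 1)
    (hu : ¬ IsUnit (strictTransform d f)) : linCoeff (alongVar d) f ≠ 0 := by
  intro h
  obtain ⟨h1, -⟩ := strictTransform_of_mult_eq_one d hf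
  rw [not_isUnit_iff_value_eq_zero, h1, h, mul_zero, add_zero] at hu
  obtain ⟨i, hi⟩ := exists_linCoeff_ne_zero hf
  refine hi ?_
  cases d <;> fin_cases i <;> assumption

theorem areTransverse_strictTransform_excEquation {d : Direction} {f : HolGerm} (hf : mult f = 1)
    (hu : ¬ IsUnit (strictTransform d f)) :
    AreTransverse (strictTransform d f) (excEquation d) := by
  rw [areTransverse_excEquation_iff, (strictTransform_of_mult_eq_one d hf).2]
  exact ⟨not_isUnit_iff_value_eq_zero.1 hu, linCoeff_alongVar_ne_zero hf hu⟩

theorem isUnit_strictTransform_or_of_areTransverse {d : Direction} {f g : HolGerm}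
    (h : AreTransverse f g) : IsUnit (strictTransform d f) ∨ IsUnit (strictTransform d g) := by
  by_contra! hcon
  obtain ⟨h1, h2, h3⟩ := h
  have hf := (strictTransform_of_mult_eq_one d h1).1
  have hg := (strictTransform_of_mult_eq_one d h2).1
  rw [not_isUnit_iff_value_eq_zero.1 hcon.1] at hf
  rw [not_isUnit_iff_value_eq_zero.1 hcon.2] at hg
  refine h3 ?_
  rw [jacobianAtZero_eq]
  cases d with
  | slope c =>
    simp only [excVar, alongVar, center] at hf hg
    linear_combination linCoeff 1 f * hg - linCoeff 1 g * hf
  | vertical =>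
    simp only [excVar, alongVar, center] at hf hg
    linear_combination linCoeff 0 g * hf - linCoeff 0 f * hg

/-- The strict transform of a smooth curve passes through only one point of the exceptional
divisor. -/
theorem direction_unique {d d' : Direction} {f : HolGerm} (hf : mult f = 1)
    (h : ¬ IsUnit (strictTransform d f)) (h' : ¬ IsUnit (strictTransform d' f)) : d = d' := by
  have hne := linCoeff_alongVar_ne_zero hf h
  have hne' := linCoeff_alongVar_ne_zero hf h'
  rw [not_isUnit_iff_value_eq_zero, (strictTransform_of_mult_eq_one _ hf).1] at h h'
  cases d with
  | slope c =>
    cases d' with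
    | slope c' =>
      simp only [excVar, alongVar, center] at h h' hne
      have : (c - c') * linCoeff 1 f = 0 := by linear_combination h - h'
      rw [sub_eq_zero.1 ((mul_eq_zero.1 this).resolve_right hne)]
    | vertical =>
      simp only [excVar, alongVar, center] at h' hne
      exact absurd (by linear_combination h') hne
  | vertical =>
    cases d' with
    | slope c' =>
      simp only [excVar, alongVar, center] at h hne'
      exact absurd (by linear_combination h) hne'
    | vertical => rfl

/-- Division by a smooth curve that is transverse to the axis `xᵢ = 0`: the remainder depends only
on `xᵢ`. -/
theorem exists_eq_mul_add_of_linCoeff_ne_zero {d : Direction} {c : HolGerm} (hc : value c = 0)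
    (hlin : linCoeff (alongVar d) c ≠ 0) (F : HolGerm) :
    ∃ q r : HolGerm, F = c * q + r ∧
      ∀ m : Fin 2 →₀ ℕ, m (alongVar d) ≠ 0 → MvPowerSeries.coeff m r.1 = 0 := by
  obtain ⟨q, r, h1, h2⟩ := exists_weierstrass_division (alongVar_ne_excVar d) 1 c F
    (fun m hm hm' => by
      rw [eq_single_of_apply_eq_zero (alongVar_ne_excVar d) hm, Nat.lt_one_iff.1 hm',
        Finsupp.single_zero]
      exact hc)
    (by rwa [linCoeff_eq_coeff] at hlin)
  exact ⟨q, r, h1, fun m hm => h2 m (Nat.one_le_iff_ne_zero.2 hm)⟩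

theorem eq_coord_pow_mul_unit {i j : Fin 2} (hij : i ≠ j) {r : HolGerm} (hr : r ≠ 0)
    (h : ∀ m : Fin 2 →₀ ℕ, m j ≠ 0 → MvPowerSeries.coeff m r.1 = 0) :
    ∃ (k : ℕ) (t : HolGerm), IsUnit t ∧ r = coord i ^ k * t := by
  obtain ⟨k, t, ht, hk⟩ := WfDvdMonoid.max_power_factor hr (coord_prime i).irreducible
  refine ⟨k, t, ?_, hk⟩
  obtain ⟨n, hn⟩ := exists_coeff_single_ne_zero hij.symm ht
  rw [isUnit_iff_value_ne_zero]
  intro h0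
  rcases Nat.eq_zero_or_pos n with rfl | hpos
  · exact hn (by rwa [Finsupp.single_zero])
  · refine hn ?_
    rw [← coeff_add_single_coord_pow_mul i k t, ← hk]
    refine h _ ?_
    simp [hij]
    omega

/-- A smooth component of the strict transform of a curve that is transverse to the exceptional
divisor is the strict transform of a smooth component of the curve: if the former is `xⱼ = r(xᵢ)`,
the latter is `xⱼ = xᵢ (r(xᵢ) + c)`. -/
theorem exists_mult_eq_one_of_dvd_strictTransform {d : Direction} {f γ' : HolGerm} (hf : f ≠ 0)
    (hγ : AreTransverse γ' (excEquation d)) (hdvd : γ' ∣ strictTransform d f) :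
    ∃ γ, mult γ = 1 ∧ γ ∣ f ∧ Associated (strictTransform d γ) γ' := by
  have hij := excVar_ne_alongVar d
  rw [areTransverse_excEquation_iff] at hγ
  obtain ⟨hγ0, hγ1⟩ := hγ
  obtain ⟨q, r, h1, hr⟩ := exists_eq_mul_add_of_linCoeff_ne_zero hγ0 hγ1 (coord (alongVar d))
  have hr0 : value r = 0 := by
    have := congrArg value h1
    rw [value_coord, map_add, map_mul, hγ0, zero_mul, zero_add] at this
    exact this.symm
  have hr1 : linCoeff (alongVar d) r = 0 := by
    rw [linCoeff_eq_coeff]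
    exact hr _ (by simp)
  have hq : IsUnit q := by
    rw [isUnit_iff_value_ne_zero]
    intro hq
    have := congrArg (linCoeff (alongVar d)) h1
    rw [linCoeff_coord_self, linCoeff_add, linCoeff_mul, hγ0, hq, hr1] at this
    simp at this
  set δ := coord (alongVar d) - r with hδ
  have hδq : δ = γ' * q := sub_eq_of_eq_add h1
  have hδexc : ¬ excEquation d ∣ δ := by
    rintro ⟨w, hw⟩
    refine hγ1 ?_
    have := congrArg (linCoeff (alongVar d)) hw
    rw [linCoeff_alongVar_excEquation_mul, hδq, linCoeff_mul, hγ0, zero_mul, zero_add] at this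
    exact (mul_eq_zero.1 this).resolve_left (isUnit_iff_value_ne_zero.1 hq)
  set γ := coord (alongVar d) + coord (excVar d) * (-r - algebraMap ℂ HolGerm (center d))
    with hγdef
  have htot : totalTransform d γ = excEquation d ^ 1 * δ := by
    rw [hγdef, map_add, map_mul, map_sub, map_neg, AlgHom.commutes, totalTransform_coord_excVar,
      totalTransform_coord_alongVar, totalTransform_eq_self d hr, hδ]
    ring
  have hvalγ : value γ = 0 := by
    rw [hγdef, map_add, map_mul, value_coord, value_coord, zero_mul, add_zero]
  have hlinγ : linCoeff (alongVar d) γ ≠ 0 := by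
    rw [hγdef, linCoeff_add, linCoeff_coord_self, ← excEquation_eq,
      linCoeff_alongVar_excEquation_mul, add_zero]
    exact one_ne_zero
  refine ⟨γ, mult_eq_one_of_linCoeff_ne_zero hvalγ hlinγ, ?_, ?_⟩
  · obtain ⟨s, t, h2, ht⟩ := exists_eq_mul_add_of_linCoeff_ne_zero hvalγ hlinγ f
    by_cases ht0 : t = 0
    · exact ⟨s, by rw [h2, ht0, add_zero]⟩
    exfalso
    obtain ⟨n, -, hn, -⟩ := strictTransform_spec d hf
    have hδf : δ ∣ totalTransform d f := by
      rw [hn, hδq]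
      exact (hq.mul_right_dvd.2 hdvd).mul_left _
    have hδt : δ ∣ t := by
      rw [h2, map_add, map_mul, htot, totalTransform_eq_self d ht, pow_one] at hδf
      exact (dvd_add_right ((dvd_mul_left δ (excEquation d)).mul_right _)).1 hδf
    obtain ⟨k, w, hw, rfl⟩ := eq_coord_pow_mul_unit hij ht0 ht
    rw [← excEquation_eq] at hδt
    have hδu := isUnit_of_dvd_unit
      (dvd_of_dvd_prime_pow_mul (excEquation_prime d) hδexc k hδt) hw
    rw [isUnit_iff_value_ne_zero, hδq, map_mul, hγ0, zero_mul] at hδu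
    exact hδu rfl
  · rw [strictTransform_eq htot hδexc, hδq]
    exact associated_mul_unit_left γ' q hq

/-! ### The strict transform of a foliation -/

theorem VectorField.apply_add (X : VectorField) (f g : HolGerm) :
    X.apply (f + g) = X.apply f + X.apply g := by
  simp only [VectorField.apply, partialDeriv_add]
  ring

theorem VectorField.apply_mul (X : VectorField) (f g : HolGerm) :
    X.apply (f * g) = f * X.apply g + g * X.apply f := by
  simp only [VectorField.apply, partialDeriv_mul]
  ring

theorem VectorField.apply_algebraMap (X : VectorField) (c : ℂ) :
    X.apply (algebraMap ℂ HolGerm c) = 0 := by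
  simp only [VectorField.apply, partialDeriv_algebraMap, mul_zero, add_zero]

theorem VectorField.apply_coord_zero (X : VectorField) : X.apply (coord 0) = X.1 := by
  rw [VectorField.apply, partialDeriv_coord_self, partialDeriv_coord_of_ne (by decide)]
  ring

theorem VectorField.apply_coord_one (X : VectorField) : X.apply (coord 1) = X.2 := by
  rw [VectorField.apply, partialDeriv_coord_self, partialDeriv_coord_of_ne (by decide)]
  ring

/-- The chain rule for the blow-up. -/
theorem pullbackField_apply_totalTransform (d : Direction) (X : VectorField) (f : HolGerm) :
    (pullbackField d X).apply (totalTransform d f) =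
      excEquation d * totalTransform d (X.apply f) := by
  refine sub_eq_zero.1 (eq_zero_of_leibniz d (fun f => (pullbackField d X).apply
    (totalTransform d f) - excEquation d * totalTransform d (X.apply f)) ?_ ?_ ?_ ?_ f)
  · intro f g
    simp only [map_add, VectorField.apply_add]
    ring
  · intro c
    simp only [AlgHom.commutes, VectorField.apply_algebraMap, map_zero, mul_zero, sub_zero]
  · intro f g
    simp only [map_mul, map_add, VectorField.apply_mul]
    ring
  · intro i
    have hx := totalTransform_coord_excVar d
    have hy := totalTransform_coord_alongVar d
    cases d with
    | slope c =>
      simp only [excVar, alongVar, center, excEquation] at hx hy ⊢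
      fin_cases i
      · simp only [Fin.zero_eta, hx, VectorField.apply_coord_zero, pullbackField, sub_self]
      · simp only [Fin.mk_one, hy, VectorField.apply_coord_one, VectorField.apply_mul,
          VectorField.apply_add, VectorField.apply_algebraMap, VectorField.apply_coord_zero,
          pullbackField]
        ring
    | vertical =>
      simp only [excVar, alongVar, center, excEquation, map_zero, add_zero] at hx hy ⊢
      fin_cases i
      · simp only [Fin.zero_eta, hy, VectorField.apply_coord_zero, VectorField.apply_mul,
          VectorField.apply_coord_one, pullbackField]
        ring
      · simp only [Fin.mk_one, hx, VectorField.apply_coord_one, pullbackField, sub_self]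

theorem exists_eq_pow_mul_of_ne_zero {p : HolGerm} (hp : Prime p) {a b : HolGerm}
    (hab : a ≠ 0 ∨ b ≠ 0) :
    ∃ (k : ℕ) (a' b' : HolGerm), a = p ^ k * a' ∧ b = p ^ k * b' ∧ ¬ (p ∣ a' ∧ p ∣ b') := by
  rcases eq_or_ne a 0 with rfl | ha
  · obtain ⟨k, b', hb', hk⟩ := WfDvdMonoid.max_power_factor (hab.resolve_left (not_not.2 rfl))
      hp.irreducible
    exact ⟨k, 0, b', by simp, hk, fun h => hb' h.2⟩
  rcases eq_or_ne b 0 with rfl | hb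
  · obtain ⟨k, a', ha', hk⟩ := WfDvdMonoid.max_power_factor ha hp.irreducible
    exact ⟨k, a', 0, hk, by simp, fun h => ha' h.1⟩
  obtain ⟨k, a', ha', hk⟩ := WfDvdMonoid.max_power_factor ha hp.irreducible
  obtain ⟨l, b', hb', hl⟩ := WfDvdMonoid.max_power_factor hb hp.irreducible
  rcases le_total k l with hkl | hkl
  · refine ⟨k, a', p ^ (l - k) * b', hk, ?_, fun h => ha' h.1⟩
    rw [hl, ← mul_assoc, ← pow_add, Nat.add_sub_cancel' hkl]
  · refine ⟨l, p ^ (k - l) * a', b', ?_, hl, fun h => hb' h.2⟩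
    rw [hk, ← mul_assoc, ← pow_add, Nat.add_sub_cancel' hkl]

theorem strictField_spec (d : Direction) {X : VectorField} (hX : X.1 ≠ 0 ∨ X.2 ≠ 0) :
    ∃ k : ℕ, pullbackField d X =
      (excEquation d ^ k * (strictField d X).1, excEquation d ^ k * (strictField d X).2) := by
  have hne : (pullbackField d X).1 ≠ 0 ∨ (pullbackField d X).2 ≠ 0 := by
    by_contra! hcon
    have key : ∀ f, X.apply f = 0 := by
      intro f
      by_contra hf
      refine mul_ne_zero (excEquation_prime d).ne_zero (totalTransform_ne_zero d hf) ?_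
      rw [← pullbackField_apply_totalTransform, VectorField.apply, hcon.1, hcon.2]
      ring
    rcases hX with h | h
    · exact h (by rw [← X.apply_coord_zero, key])
    · exact h (by rw [← X.apply_coord_one, key])
  obtain ⟨k, a, b, ha, hb, hab⟩ := exists_eq_pow_mul_of_ne_zero (excEquation_prime d) hne
  have hex : ∃ Y : VectorField,
      (∃ k : ℕ, pullbackField d X = (excEquation d ^ k * Y.1, excEquation d ^ k * Y.2)) ∧
        ¬ (excEquation d ∣ Y.1 ∧ excEquation d ∣ Y.2) :=
    ⟨(a, b), ⟨k, Prod.ext ha hb⟩, hab⟩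
  exact (Classical.epsilon_spec hex).1

theorem isInvariant_strictTransform (d : Direction) {X : VectorField} (hX : X.1 ≠ 0 ∨ X.2 ≠ 0)
    {f : HolGerm} (hf : f ≠ 0) (hinv : IsInvariant X f) :
    IsInvariant (strictField d X) (strictTransform d f) := by
  obtain ⟨k, hk⟩ := strictField_spec d hX
  obtain ⟨n, -, hn, hexc⟩ := strictTransform_spec d hf
  obtain ⟨s, hs⟩ := hinv
  have h1 := pullbackField_apply_totalTransform d X f
  set Y := strictField d X
  set f' := strictTransform d f
  have h2 : ∀ g, (pullbackField d X).apply g = excEquation d ^ k * Y.apply g := by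
    intro g
    rw [hk]
    simp only [VectorField.apply]
    ring
  rw [h2, hs, map_mul, hn, VectorField.apply_mul] at h1
  refine dvd_of_dvd_prime_pow_mul (excEquation_prime d) hexc (k + n) ?_
  refine ⟨excEquation d ^ (n + 1) * totalTransform d s -
    excEquation d ^ k * Y.apply (excEquation d ^ n), ?_⟩
  rw [pow_add, pow_succ]
  linear_combination h1

theorem IsInvariant.mul {X : VectorField} {f g : HolGerm} (hf : IsInvariant X f)
    (hg : IsInvariant X g) : IsInvariant X (f * g) := by
  rw [IsInvariant, VectorField.apply_mul]
  exact dvd_add (mul_dvd_mul_left f hg) (mul_comm g (X.apply f) ▸ mul_dvd_mul_right hf g)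

theorem IsInvariant.of_associated {X : VectorField} {f g : HolGerm} (hf : IsInvariant X f)
    (h : Associated f g) : IsInvariant X g := by
  obtain ⟨u, rfl⟩ := h
  rw [IsInvariant, VectorField.apply_mul, u.isUnit.mul_right_dvd]
  exact dvd_add (dvd_mul_right f _) (hf.mul_left _)

theorem IsInvariant.of_dvd {X : VectorField} {f γ : HolGerm} (hf : IsInvariant X f)
    (hsq : Squarefree f) (hγ : Prime γ) (h : γ ∣ f) : IsInvariant X γ := by
  obtain ⟨s, rfl⟩ := h
  have h1 : γ ∣ γ * X.apply s + s * X.apply γ := by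
    rw [← VectorField.apply_mul]
    exact (dvd_mul_right γ s).trans hf
  refine (hγ.dvd_or_dvd ((dvd_add_right (dvd_mul_right γ _)).1 h1)).resolve_left fun hs => ?_
  exact hγ.not_isUnit (hsq γ (mul_dvd_mul_left γ hs))

/-! ### Curves at infinitely near points -/

theorem curveAt_ne_zero (q : List Direction) {f : HolGerm} (hf : f ≠ 0) : curveAt q f ≠ 0 := by
  induction q generalizing f with
  | nil => exact hf
  | cons d q ih => exact ih (strictTransform_ne_zero d hf)

theorem curveAt_mul (q : List Direction) {f g : HolGerm} (hf : f ≠ 0) (hg : g ≠ 0) :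
    curveAt q (f * g) = curveAt q f * curveAt q g := by
  induction q generalizing f g with
  | nil => rfl
  | cons d q ih =>
    change curveAt q _ = _
    rw [strictTransform_mul d hf hg]
    exact ih (strictTransform_ne_zero d hf) (strictTransform_ne_zero d hg)

theorem isUnit_curveAt (q : List Direction) {f : HolGerm} (hf : IsUnit f) :
    IsUnit (curveAt q f) := by
  induction q generalizing f with
  | nil => exact hf
  | cons d q ih => exact ih (isUnit_strictTransform d hf)

theorem curveAt_append (q q' : List Direction) (f : HolGerm) :
    curveAt (q ++ q') f = curveAt q' (curveAt q f) := by
  induction q generalizing f with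
  | nil => rfl
  | cons d q ih => exact ih _

theorem curveAt_dvd (q : List Direction) {f g : HolGerm} (hg : g ≠ 0) (h : f ∣ g) :
    curveAt q f ∣ curveAt q g := by
  obtain ⟨s, rfl⟩ := h
  rw [curveAt_mul q (left_ne_zero_of_mul hg) (right_ne_zero_of_mul hg)]
  exact dvd_mul_right _ _

theorem curveAt_associated (q : List Direction) {f g : HolGerm} (hf : f ≠ 0)
    (h : Associated f g) : Associated (curveAt q f) (curveAt q g) := by
  obtain ⟨u, rfl⟩ := h
  rw [curveAt_mul q hf u.ne_zero]
  exact (associated_mul_unit_left _ _ (isUnit_curveAt q u.isUnit)).symm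

theorem exists_irreducible_not_isUnit_curveAt (q : List Direction) {g : HolGerm} (hg : g ≠ 0)
    (h : ¬ IsUnit (curveAt q g)) :
    ∃ γ, Irreducible γ ∧ γ ∣ g ∧ ¬ IsUnit (curveAt q γ) := by
  induction g using WfDvdMonoid.induction_on_irreducible with
  | zero => exact absurd rfl hg
  | unit u hu => exact absurd (isUnit_curveAt q hu) h
  | mul a i ha hi ih =>
    rw [curveAt_mul q hi.ne_zero ha, IsUnit.mul_iff, not_and_or] at h
    rcases h with h | h
    · exact ⟨i, hi, dvd_mul_right i a, h⟩
    · obtain ⟨γ, h1, h2, h3⟩ := ih ha h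
      exact ⟨γ, h1, h2.mul_left i, h3⟩

theorem prefix_or_prefix_of_not_isUnit_curveAt {q q' : List Direction} {e : HolGerm}
    (he : mult e = 1) (h : ¬ IsUnit (curveAt q e)) (h' : ¬ IsUnit (curveAt q' e)) :
    q <+: q' ∨ q' <+: q := by
  induction q generalizing q' e with
  | nil => exact Or.inl List.nil_prefix
  | cons d q ih =>
    cases q' with
    | nil => exact Or.inr List.nil_prefix
    | cons d' q' =>
      have hd : ¬ IsUnit (strictTransform d e) := fun hu => h (isUnit_curveAt q hu)
      have hd' : ¬ IsUnit (strictTransform d' e) := fun hu => h' (isUnit_curveAt q' hu)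
      obtain rfl := direction_unique he hd hd'
      simp only [List.cons_prefix_cons, true_and]
      exact ih (areTransverse_strictTransform_excEquation he hd).1 h h'

/-! ### The exceptional divisor at infinitely near points -/

theorem excFrom_eq (q : List Direction) {E : Set HolGerm} (hE : ∀ e ∈ E, ¬ IsUnit e) :
    excFrom q E = excAt q ∪ {g | ¬ IsUnit g ∧ ∃ e ∈ E, g = curveAt q e} := by
  induction q generalizing E with
  | nil =>
    ext g
    simp only [excFrom, excAt, curveAt, Set.empty_union, Set.mem_ofPred_eq, exists_eq_right']
    exact ⟨fun h => ⟨hE g h, h⟩, fun h => h.2⟩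
  | cons d q ih =>
    have hstep : ∀ E : Set HolGerm, ∀ e ∈ excStep d E, ¬ IsUnit e := by
      rintro E e (rfl | he)
      · exact (excEquation_prime d).not_isUnit
      · exact he.1
    have h0 : excAt (d :: q) = excFrom q (excStep d ∅) := rfl
    rw [h0]
    change excFrom q (excStep d E) = _
    rw [ih (hstep E), ih (hstep ∅)]
    ext g
    simp only [Set.mem_union, Set.mem_ofPred_eq, excStep, Set.mem_insert_iff, curveAt]
    constructor
    · rintro (h | ⟨hg, e, (rfl | ⟨-, e', he', rfl⟩), rfl⟩)
      · exact Or.inl (Or.inl h)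
      · exact Or.inl (Or.inr ⟨hg, _, Or.inl rfl, rfl⟩)
      · exact Or.inr ⟨hg, e', he', rfl⟩
    · rintro ((h | ⟨hg, e, (rfl | ⟨-, e', he', -⟩), rfl⟩) | ⟨hg, e, he, rfl⟩)
      · exact Or.inl h
      · exact Or.inr ⟨hg, _, Or.inl rfl, rfl⟩
      · exact absurd he' (Set.notMem_empty e')
      · exact Or.inr ⟨hg, _, Or.inr ⟨fun hu => hg (isUnit_curveAt q hu), e, he, rfl⟩, rfl⟩

theorem mem_excAt_cons_iff {d : Direction} {q : List Direction} {g : HolGerm} :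
    g ∈ excAt (d :: q) ↔ g ∈ excAt q ∨ ¬ IsUnit g ∧ g = curveAt q (excEquation d) := by
  have h : excStep d ∅ = {excEquation d} := by
    ext g
    simp [excStep]
  have h0 : excAt (d :: q) = excFrom q {excEquation d} := by
    rw [← h]
    rfl
  rw [h0, excFrom_eq q (by rintro e rfl; exact (excEquation_prime d).not_isUnit)]
  simp

theorem excAt_subset_cons (d : Direction) (q : List Direction) : excAt q ⊆ excAt (d :: q) :=
  fun _ hg => mem_excAt_cons_iff.2 (Or.inl hg)

theorem excAt_singleton (d : Direction) : excAt [d] = {excEquation d} := by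
  ext g
  rw [mem_excAt_cons_iff]
  simp only [excAt, excFrom, curveAt, Set.mem_empty_iff_false, false_or, Set.mem_singleton_iff]
  refine ⟨fun h => h.2, ?_⟩
  rintro rfl
  exact ⟨(excEquation_prime d).not_isUnit, rfl⟩

theorem excAt_nonempty {q : List Direction} (hq : q ≠ []) : (excAt q).Nonempty := by
  induction q with
  | nil => exact absurd rfl hq
  | cons d q ih =>
    rcases eq_or_ne q [] with rfl | h
    · rw [excAt_singleton]
      exact Set.singleton_nonempty _
    · exact (ih h).mono (excAt_subset_cons d q)

theorem excAt_cons_of_isUnit {d : Direction} {q : List Direction}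
    (h : IsUnit (curveAt q (excEquation d))) : excAt (d :: q) = excAt q := by
  ext g
  rw [mem_excAt_cons_iff]
  refine ⟨?_, Or.inl⟩
  rintro (hg | ⟨hg, rfl⟩)
  · exact hg
  · exact absurd h hg

/-- After a blow-up, only the new component of the exceptional divisor passes through the points of
the strict transform of a smooth curve transverse to the old components. -/
theorem excStep_eq_singleton {d : Direction} {E : Set HolGerm} {e : HolGerm}
    (hE : ∀ D ∈ E, AreTransverse e D) (hu : ¬ IsUnit (strictTransform d e)) :
    excStep d E = {excEquation d} := by
  ext g
  simp only [excStep, Set.mem_insert_iff, Set.mem_ofPred_eq, Set.mem_singleton_iff]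
  refine ⟨?_, Or.inl⟩
  rintro (rfl | ⟨hg, D, hD, rfl⟩)
  · rfl
  · exact absurd ((isUnit_strictTransform_or_of_areTransverse (hE D hD)).resolve_left hu) hg

/-- The strict transforms of a smooth curve remain smooth and have normal crossings with the
exceptional divisor. -/
theorem areTransverse_curveAt (q : List Direction) {E : Set HolGerm} {e : HolGerm}
    (he : mult e = 1) (hE : ∀ D ∈ E, AreTransverse e D) (hs : E.Subsingleton)
    (hu : ¬ IsUnit (curveAt q e)) :
    mult (curveAt q e) = 1 ∧ (excFrom q E).Subsingleton ∧
      ∀ D ∈ excFrom q E, AreTransverse (curveAt q e) D := by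
  induction q generalizing E e with
  | nil => exact ⟨he, hs, hE⟩
  | cons d q ih =>
    have hd : ¬ IsUnit (strictTransform d e) := fun h => hu (isUnit_curveAt q h)
    have htr := areTransverse_strictTransform_excEquation he hd
    have hstep := excStep_eq_singleton hE hd
    change _ ∧ (excFrom q (excStep d E)).Subsingleton ∧ ∀ D ∈ excFrom q (excStep d E), _
    rw [hstep]
    exact ih htr.1 (by rintro D rfl; exact htr) Set.subsingleton_singleton hu

/-- If a smooth branch of the strict transform of a curve at an infinitely near point of a smooth
curve `e = 0` is transverse to the exceptional divisor, then it is the strict transform of a smooth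
branch of the curve, which is tangent to `e = 0`. -/
theorem exists_mult_eq_one_of_dvd_curveAt (q : List Direction) {E : Set HolGerm}
    {e f γ' : HolGerm} (he : mult e = 1) (hE : ∀ D ∈ E, AreTransverse e D)
    (hu : ¬ IsUnit (curveAt q e)) (hf : f ≠ 0) (hγ : mult γ' = 1) (hdvd : γ' ∣ curveAt q f)
    (htr : ∀ D ∈ excFrom q E, AreTransverse γ' D) :
    ∃ γ, mult γ = 1 ∧ γ ∣ f ∧ Associated (curveAt q γ) γ' ∧ (∀ D ∈ E, AreTransverse γ D) ∧
      (q ≠ [] → ¬ AreTransverse γ e) := by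
  induction q generalizing E e f with
  | nil => exact ⟨γ', hγ, hdvd, Associated.refl _, htr, fun h => absurd rfl h⟩
  | cons d q ih =>
    have hd : ¬ IsUnit (strictTransform d e) := fun h => hu (isUnit_curveAt q h)
    have hexc := areTransverse_strictTransform_excEquation he hd
    have hstep := excStep_eq_singleton hE hd
    have htr' : ∀ D ∈ excFrom q (excStep d E), AreTransverse γ' D := htr
    rw [hstep] at htr'
    obtain ⟨γ₁, h1, h2, h3, h4, -⟩ := ih (E := {excEquation d}) hexc.1
      (by rintro D rfl; exact hexc) hu (strictTransform_ne_zero d hf) hdvd htr'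
    obtain ⟨γ, h5, h6, h7⟩ := exists_mult_eq_one_of_dvd_strictTransform hf (h4 _ rfl) h2
    have hnt : ¬ AreTransverse γ e := by
      intro h
      refine (isUnit_strictTransform_or_of_areTransverse h).elim (fun hγu => ?_) hd
      exact one_le_mult_iff.1 h1.ge (h7.isUnit hγu)
    refine ⟨γ, h5, h6, ?_, fun D hD => ?_, fun _ => hnt⟩
    · exact (curveAt_associated q (strictTransform_ne_zero d (ne_zero_of_mult_eq_one h5)) h7).trans
        h3
    · exact (hE D hD).of_not_areTransverse h5 hnt

/-! ### Desingularizations -/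

theorem mult_eq_of_associated {f g : HolGerm} (h : Associated f g) : mult f = mult g := by
  obtain ⟨u, rfl⟩ := h
  rw [mult_mul, mult_eq_zero_iff.2 u.isUnit, add_zero]

theorem AreTransverse.of_associated {f f' g : HolGerm} (h : AreTransverse f g)
    (hf : Associated f f') : AreTransverse f' g := by
  obtain ⟨u, rfl⟩ := hf
  rw [mul_comm]
  exact h.mul_units_left u.isUnit

theorem IsDesingularizedAt.of_associated {f g : HolGerm} {q : List Direction}
    (h : IsDesingularizedAt f q) (hfg : Associated (curveAt q f) (curveAt q g)) :
    IsDesingularizedAt g q := by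
  rcases h with h | ⟨h1, h2, h3⟩
  · exact Or.inl (hfg.isUnit h)
  · exact Or.inr ⟨(mult_eq_of_associated hfg).symm.trans h1, h2,
      fun D hD => (h3 D hD).of_associated hfg⟩

theorem IsDesingularizedAt.mult_le_one {f : HolGerm} {q : List Direction}
    (h : IsDesingularizedAt f q) : mult (curveAt q f) ≤ 1 := by
  rcases h with h | h
  · rw [mult_eq_zero_iff.2 h]
    exact zero_le_one
  · exact h.1.le

theorem not_isDesingularizedAt_of_mul_dvd {f a b : HolGerm} {q : List Direction}
    (ha : ¬ IsUnit a) (hb : ¬ IsUnit b) (h : a * b ∣ curveAt q f) : ¬ IsDesingularizedAt f q := by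
  intro hdes
  have h1 := add_le_add (one_le_mult_iff.2 ha) (one_le_mult_iff.2 hb)
  rw [← mult_mul] at h1
  exact absurd ((h1.trans (mult_le_of_dvd h)).trans hdes.mult_le_one) (by decide)

theorem IsDesingularizedAt.of_cons {f : HolGerm} {d : Direction} {q : List Direction}
    (h : IsDesingularizedAt f (d :: q)) : IsDesingularizedAt (strictTransform d f) q := by
  rcases h with h | ⟨h1, h2, h3⟩
  · exact Or.inl h
  · exact Or.inr ⟨h1, h2.anti (excAt_subset_cons d q),
      fun D hD => h3 D (excAt_subset_cons d q hD)⟩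

theorem IsDesingularizedAt.cons {f : HolGerm} {d : Direction} {q : List Direction}
    (h : IsDesingularizedAt (strictTransform d f) q)
    (hu : IsUnit (curveAt q (excEquation d))) : IsDesingularizedAt f (d :: q) := by
  rw [IsDesingularizedAt, excAt_cons_of_isUnit hu]
  exact h

theorem nil_mem_of_two_le_mult {f : HolGerm} {T : Set (List Direction)}
    (hT : IsDesingularization f T) (hf : 2 ≤ mult f) : [] ∈ T := by
  by_contra hnil
  have h := (hT.2 [] ⟨hnil, fun p hp hne => absurd (List.prefix_nil.1 hp) hne⟩).mult_le_one
  exact absurd (hf.trans h) (by decide)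

theorem IsBlowUpSequence.mem_of_prefix {T : Set (List Direction)} (hT : IsBlowUpSequence T)
    {p q : List Direction} (hq : q ∈ T) (hpq : p <+: q) : p ∈ T := by
  obtain ⟨t, rfl⟩ := hpq
  induction t using List.reverseRecOn with
  | nil => simpa using hq
  | append_singleton t d ih =>
    rw [← List.append_assoc] at hq
    exact ih (hT.2 _ _ hq)

theorem isPointOver_append_singleton {T : Set (List Direction)} (hT : IsBlowUpSequence T)
    {q : List Direction} {d : Direction} (hq : q ∈ T) (hd : q ++ [d] ∉ T) :
    IsPointOver T (q ++ [d]) := by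
  refine ⟨hd, fun p hp hne => hT.mem_of_prefix hq ?_⟩
  exact (List.prefix_concat_iff.1 hp).resolve_left hne

/-- The strict transform of a curve meets the exceptional divisor. -/
theorem exists_isPointOver_not_isUnit {T : Set (List Direction)} (hT : IsBlowUpSequence T)
    {a : HolGerm} (ha : a ≠ 0) (hu : ¬ IsUnit a) :
    ∃ q, IsPointOver T q ∧ ¬ IsUnit (curveAt q a) := by
  by_contra! hcon
  have key : ∀ n : ℕ, ∃ q ∈ T, q.length = n ∧ ¬ IsUnit (curveAt q a) := by
    intro n
    induction n with
    | zero =>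
      refine ⟨[], ?_, rfl, hu⟩
      by_contra hnil
      exact hu (hcon [] ⟨hnil, fun p hp hne => absurd (List.prefix_nil.1 hp) hne⟩)
    | succ n ih =>
      obtain ⟨q, hq, hlen, hqu⟩ := ih
      obtain ⟨d, hd⟩ := exists_not_isUnit_strictTransform (curveAt_ne_zero q ha) hqu
      have hd' : ¬ IsUnit (curveAt (q ++ [d]) a) := by
        rw [curveAt_append]
        exact hd
      refine ⟨q ++ [d], ?_, by simp [hlen], hd'⟩
      by_contra hqd
      exact hd' (hcon _ (isPointOver_append_singleton hT hq hqd))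
  refine Set.infinite_univ (α := ℕ) ((hT.1.image List.length).subset fun n _ => ?_)
  obtain ⟨q, hq, hlen, -⟩ := key n
  exact ⟨q, hq, hlen⟩

/-- A curve with a desingularization is reduced. -/
theorem IsDesingularization.squarefree {f : HolGerm} {T : Set (List Direction)}
    (hT : IsDesingularization f T) (hf : f ≠ 0) : Squarefree f := by
  intro a ha
  by_contra hu
  have ha0 : a ≠ 0 := left_ne_zero_of_mul (ne_zero_of_dvd_ne_zero hf ha)
  obtain ⟨q, hq, hqu⟩ := exists_isPointOver_not_isUnit hT.1 ha0 hu
  refine not_isDesingularizedAt_of_mul_dvd hqu hqu ?_ (hT.2 q hq)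
  rw [← curveAt_mul q ha0 ha0]
  exact curveAt_dvd q hf ha

/-- The intersection of the desingularizations of a curve is the minimal one. -/
theorem IsDesingularization.exists_minimal {f : HolGerm} {T₀ : Set (List Direction)}
    (hT₀ : IsDesingularization f T₀) :
    ∃ T, IsMinimalDesingularization f T ∧ T ⊆ T₀ := by
  refine ⟨⋂₀ {T | IsDesingularization f T}, ⟨⟨⟨hT₀.1.1.subset (Set.sInter_subset_of_mem hT₀),
    fun q d h T hT => hT.1.2 q d (h T hT)⟩, fun q hq => ?_⟩,
    fun T hT => Set.sInter_subset_of_mem hT⟩, Set.sInter_subset_of_mem hT₀⟩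
  have h := hq.1
  simp only [Set.mem_sInter, Set.mem_ofPred_eq, not_forall] at h
  obtain ⟨T, hT, hqT⟩ := h
  exact hT.2 q ⟨hqT, fun p hp hne => hq.2 p hp hne T hT⟩

/-- The minimal desingularization only blows up points where the curve is not desingularized: the
other points of the blow-up sequence can be omitted with all the points infinitely near to them. -/
theorem IsMinimalDesingularization.not_isDesingularizedAt {f : HolGerm}
    {T : Set (List Direction)} (hT : IsMinimalDesingularization f T) {q : List Direction}
    (hq : q ∈ T) : ¬ IsDesingularizedAt f q := by
  intro hdes
  have hmem : {p ∈ T | ¬ q <+: p} ∈ {T' | IsDesingularization f T'} := by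
    refine ⟨⟨hT.1.1.1.subset fun p hp => hp.1, fun p d h => ⟨hT.1.1.2 p d h.1, fun hqp =>
      h.2 (hqp.trans (List.prefix_append p [d]))⟩⟩, fun p hp => ?_⟩
    by_cases hpT : p ∈ T
    · have hqp : q <+: p := by
        by_contra hqp
        exact hp.1 ⟨hpT, hqp⟩
      by_cases hne : q = p
      · rwa [← hne]
      · exact absurd (List.prefix_refl q) (hp.2 q hqp hne).2
    · exact hT.1.2 p ⟨hpT, fun p' hp' hne => (hp.2 p' hp' hne).1⟩
  exact (hT.2 hmem hq).2 (List.prefix_refl q)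

/-! ### Weakly isolated curves after a blow-up -/

theorem dvd_of_squarefree_of_forall_irreducible {a b : HolGerm} (ha : Squarefree a)
    (h : ∀ p, Irreducible p → p ∣ a → p ∣ b) : a ∣ b := by
  induction a using WfDvdMonoid.induction_on_irreducible with
  | zero => exact absurd ha not_squarefree_zero
  | unit u hu => exact hu.dvd
  | mul a i ha0 hi ih =>
    obtain ⟨w, rfl⟩ := ih ha.of_mul_right fun p hp hpa => h p hp (hpa.mul_left i)
    have hia : ¬ i ∣ a := fun hia => hi.not_isUnit (ha i (mul_dvd_mul_left i hia))
    rw [mul_comm i a]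
    exact mul_dvd_mul_left a
      (((prime_of_irreducible hi).dvd_or_dvd (h i hi (dvd_mul_right i a))).resolve_left hia)

theorem associated_of_squarefree {a b : HolGerm} (ha : Squarefree a) (hb : Squarefree b)
    (h : ∀ p, Irreducible p → (p ∣ a ↔ p ∣ b)) : Associated a b :=
  associated_of_dvd_dvd
    (dvd_of_squarefree_of_forall_irreducible ha fun p hp => (h p hp).1)
    (dvd_of_squarefree_of_forall_irreducible hb fun p hp => (h p hp).2)

theorem IsNormalCrossings.of_associated {v w : HolGerm} (hv : IsNormalCrossings v)
    (h : Associated v w) : IsNormalCrossings w := by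
  rcases hv with hv | hv | ⟨v₁, v₂, rfl, hv⟩
  · exact Or.inl (h.isUnit hv)
  · exact Or.inr (Or.inl ((mult_eq_of_associated h).symm.trans hv))
  · obtain ⟨u, rfl⟩ := h
    exact Or.inr (Or.inr ⟨u * v₁, v₂, by ring, hv.mul_units_left u.isUnit⟩)

theorem IsNormalCrossings.mul_of_isUnit_or {v w : HolGerm} (hw : mult w = 1)
    (h : IsUnit v ∨ AreTransverse v w) : IsNormalCrossings (v * w) := by
  rcases h with h | h
  · exact Or.inr (Or.inl (by rw [mult_mul, mult_eq_zero_iff.2 h, zero_add, hw]))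
  · exact Or.inr (Or.inr ⟨v, w, rfl, h⟩)

/-- At most one branch of a normal-crossings divisor passes through a given point of the exceptional
divisor after a blow-up, and this branch is smooth and transverse to the exceptional divisor. -/
theorem IsNormalCrossings.strictTransform {v : HolGerm} (hv : IsNormalCrossings v)
    (d : Direction) :
    IsUnit (strictTransform d v) ∨ AreTransverse (strictTransform d v) (excEquation d) := by
  have key : ∀ w, mult w = 1 → IsUnit (FolGerm.strictTransform d w) ∨
      AreTransverse (FolGerm.strictTransform d w) (excEquation d) := fun w hw =>
    or_iff_not_imp_left.2 fun hu => areTransverse_strictTransform_excEquation hw hu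
  rcases hv with hv | hv | ⟨v₁, v₂, rfl, hv⟩
  · exact Or.inl (isUnit_strictTransform d hv)
  · exact key v hv
  · have h1 := hv.1
    have h2 := hv.2.1
    rw [strictTransform_mul d (ne_zero_of_mult_eq_one h1) (ne_zero_of_mult_eq_one h2)]
    rcases isUnit_strictTransform_or_of_areTransverse (d := d) hv with hu | hu
    · rcases key v₂ h2 with h | h
      · exact Or.inl (hu.mul h)
      · exact Or.inr (h.mul_units_left hu)
    · rcases key v₁ h1 with h | h
      · exact Or.inl (h.mul hu)
      · right
        rw [mul_comm]
        exact h.mul_units_left hu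

theorem isPointOver_cons {T : Set (List Direction)} (hnil : [] ∈ T) {P : Direction}
    {q : List Direction} (hq : P :: q ∉ T) (h : ∀ p, p <+: q → p ≠ q → P :: p ∈ T) :
    IsPointOver T (P :: q) := by
  refine ⟨hq, fun p hp hne => ?_⟩
  cases p with
  | nil => exact hnil
  | cons d p =>
    obtain ⟨rfl, hpq⟩ := List.cons_prefix_cons.1 hp
    exact h p hpq fun hpq' => hne (by rw [hpq'])

theorem IsBlowUpSequence.tail {T : Set (List Direction)} (hT : IsBlowUpSequence T)
    (P : Direction) : IsBlowUpSequence {q | P :: q ∈ T} :=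
  ⟨hT.1.preimage fun _ _ _ _ h => (List.cons.inj h).2, fun q d h => hT.2 (P :: q) d h⟩

theorem IsDesingularization.tail {f : HolGerm} {T : Set (List Direction)}
    (hT : IsDesingularization f T) (hnil : [] ∈ T) (P : Direction) :
    IsDesingularization (strictTransform P f) {q | P :: q ∈ T} :=
  ⟨hT.1.tail P, fun q hq => (hT.2 (P :: q) (isPointOver_cons hnil hq.1 hq.2)).of_cons⟩

/-- A desingularization of `f` also desingularizes the union of the strict transform of `f` and the
exceptional divisor. -/
theorem IsDesingularization.tail_mul_excEquation {f : HolGerm} {T : Set (List Direction)}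
    (hT : IsDesingularization f T) (hf : f ≠ 0) {P : Direction} (hP : [P] ∈ T) :
    IsDesingularization (strictTransform P f * excEquation P) {q | P :: q ∈ T} := by
  have hnil : [] ∈ T := hT.1.2 [] P hP
  refine ⟨hT.1.tail P, fun q hq => ?_⟩
  have hq0 : q ≠ [] := by
    rintro rfl
    exact hq.1 hP
  have hdes := hT.2 (P :: q) (isPointOver_cons hnil hq.1 hq.2)
  have hmul := curveAt_mul q (strictTransform_ne_zero P hf) (excEquation_prime P).ne_zero
  obtain ⟨D, hD⟩ := excAt_nonempty hq0
  by_cases he : IsUnit (curveAt q (excEquation P))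
  · refine hdes.of_cons.of_associated ?_
    rw [hmul]
    exact (associated_mul_unit_left _ _ he).symm
  · obtain ⟨h1, h2, h3⟩ := areTransverse_curveAt q (E := ∅) (mult_excEquation P)
      (fun D hD => absurd hD (Set.notMem_empty D)) Set.subsingleton_empty he
    rcases hdes with hu | ⟨-, hsub, -⟩
    · refine IsDesingularizedAt.of_associated (f := excEquation P) (Or.inr ⟨h1, h2, h3⟩) ?_
      rw [hmul]
      exact (associated_unit_mul_left _ _ hu).symm
    · have heD : curveAt q (excEquation P) = D :=
        hsub (mem_excAt_cons_iff.2 (Or.inr ⟨he, rfl⟩)) (excAt_subset_cons P q hD)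
      exact absurd (heD ▸ h3 D hD) (not_areTransverse_self D)

/-- Two smooth transverse curves are separated by one blow-up. -/
theorem AreTransverse.isDesingularization {a b : HolGerm} (h : AreTransverse a b) :
    IsDesingularization (a * b) {[]} := by
  refine ⟨⟨Set.finite_singleton _, fun q d hq => by simp at hq⟩, fun q hq => ?_⟩
  cases q with
  | nil => exact absurd rfl hq.1
  | cons d q =>
    obtain rfl : q = [] := by
      by_contra hne
      have h1 := hq.2 [d] (by simp) (by simpa using Ne.symm hne)
      simp at h1
    have key : ∀ w, mult w = 1 → IsDesingularizedAt w [d] := by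
      intro w hw
      refine or_iff_not_imp_left.2 fun hu => ?_
      have htr := areTransverse_strictTransform_excEquation hw hu
      rw [excAt_singleton]
      exact ⟨htr.1, Set.subsingleton_singleton, by rintro D rfl; exact htr⟩
    have hmul := curveAt_mul [d] (ne_zero_of_mult_eq_one h.1) (ne_zero_of_mult_eq_one h.2.1)
    rcases isUnit_strictTransform_or_of_areTransverse (d := d) h with hu | hu
    · refine (key b h.2.1).of_associated ?_
      rw [hmul]
      exact (associated_unit_mul_left _ _ hu).symm
    · refine (key a h.1).of_associated ?_
      rw [hmul]
      exact (associated_mul_unit_left _ _ hu).symm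

theorem IsDesingularization.of_associated {f g : HolGerm} {T : Set (List Direction)}
    (hT : IsDesingularization f T) (hf : f ≠ 0) (h : Associated f g) :
    IsDesingularization g T :=
  ⟨hT.1, fun q hq => (hT.2 q hq).of_associated (curveAt_associated q hf h)⟩

/-- The inequality `κ ≥ 1` at a point of the strict transform of the important part of `f`, where
the strict transform of `f` is desingularized and which is not on the strict transform of the first
exceptional divisor: it is also a point over the minimal desingularization of `f`, with the same
components of the exceptional divisor. -/
theorem one_le_kappa_of_strictTransform {X : VectorField} {f g : HolGerm}
    {T : Set (List Direction)} (hT : IsMinimalDesingularization f T) (hnil : [] ∈ T) (hg : g ≠ 0)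
    (hX : ∀ γ, Irreducible γ → γ ∣ g → IsNonNull X T γ) {P : Direction} {q : List Direction}
    (hpre : ∀ p, p <+: q → p ≠ q → P :: p ∈ T)
    (hdes : IsDesingularizedAt (strictTransform P f) q)
    (he : IsUnit (curveAt q (excEquation P)))
    (hgq : ¬ IsUnit (curveAt q (strictTransform P g))) {D : HolGerm} (hD : D ∈ excAt q) :
    1 ≤ kappa (fieldAt q (strictField P X)) (excAt q) D := by
  have hover : IsPointOver T (P :: q) :=
    isPointOver_cons hnil (fun hq => hT.not_isDesingularizedAt hq (hdes.cons he)) hpre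
  obtain ⟨γ, h1, h2, h3⟩ := exists_irreducible_not_isUnit_curveAt (P :: q) hg hgq
  have h4 := hX γ h1 h2 (P :: q) hover h3
  rw [excAt_cons_of_isUnit he] at h4
  exact h4 D hD

theorem IsInvariantTotalTransform.associated {X : VectorField} {f h : HolGerm} {P : Direction}
    (hh : IsInvariantTotalTransform X f P h) (hf : 1 ≤ mult f) (hf0 : f ≠ 0)
    (hsq : Squarefree (strictTransform P f))
    (hinv : IsInvariant (strictField P X) (strictTransform P f)) :
    (IsInvariant (strictField P X) (excEquation P) →
      Associated h (strictTransform P f * excEquation P)) ∧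
    (¬ IsInvariant (strictField P X) (excEquation P) → Associated h (strictTransform P f)) := by
  obtain ⟨n, hn, htot, hexc⟩ := strictTransform_spec P hf0
  have hn0 : n ≠ 0 := by
    rintro rfl
    rw [hn] at hf
    exact absurd hf (by decide)
  have hprime := excEquation_prime P
  have hdvd : ∀ γ, Irreducible γ →
      (γ ∣ totalTransform P f ↔ γ ∣ strictTransform P f ∨ Associated γ (excEquation P)) := by
    intro γ hγ
    have hγ' := prime_of_irreducible hγ
    rw [htot]
    constructor
    · intro h
      rcases hγ'.dvd_or_dvd h with h | h
      · exact Or.inr (hγ'.associated_of_dvd hprime (hγ'.dvd_of_dvd_pow h))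
      · exact Or.inl h
    · rintro (h | h)
      · exact h.mul_left _
      · exact (h.dvd.trans (dvd_pow_self _ hn0)).mul_right _
  constructor
  · intro he
    have hsq' : Squarefree (strictTransform P f * excEquation P) :=
      squarefree_mul_iff.2
        ⟨(hprime.irreducible.isRelPrime_iff_not_dvd.2 hexc).symm, hsq, hprime.squarefree⟩
    refine associated_of_squarefree hh.1 hsq' fun γ hγ => ?_
    have hγ' := prime_of_irreducible hγ
    rw [hh.2 γ hγ, hdvd γ hγ]
    constructor
    · rintro ⟨h | h, -⟩
      · exact h.mul_right _
      · exact h.dvd.mul_left _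
    · intro h
      rcases hγ'.dvd_or_dvd h with h | h
      · exact ⟨Or.inl h, hinv.of_dvd hsq hγ' h⟩
      · have hass := hγ'.associated_of_dvd hprime h
        exact ⟨Or.inr hass, he.of_associated hass.symm⟩
  · intro he
    refine associated_of_squarefree hh.1 hsq fun γ hγ => ?_
    have hγ' := prime_of_irreducible hγ
    rw [hh.2 γ hγ, hdvd γ hγ]
    constructor
    · rintro ⟨h | h, hγinv⟩
      · exact h
      · exact absurd (hγinv.of_associated h) he
    · exact fun h => ⟨Or.inl h, hinv.of_dvd hsq hγ' h⟩

/-- The case of an invariant exceptional divisor, which is added to the normal-crossings part. -/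
theorem isWeaklyIsolated_of_associated_mul_excEquation {X : VectorField} {f g v h : HolGerm}
    {T : Set (List Direction)} {P : Direction} (hf : 2 ≤ mult f) (hf0 : f ≠ 0) (hfgv : f = g * v)
    (hv : IsNormalCrossings v) (hT : IsMinimalDesingularization f T)
    (hX : ∀ γ, Irreducible γ → γ ∣ g → IsNonNull X T γ) (hsq : Squarefree h) (hmult : 2 ≤ mult h)
    (hinv : IsInvariant (strictField P X) h)
    (hh : Associated (strictTransform P f * excEquation P) h) :
    IsWeaklyIsolated (strictField P X) h := by
  have hnil := nil_mem_of_two_le_mult hT.1 hf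
  have he0 := (excEquation_prime P).ne_zero
  have hf'0 := strictTransform_ne_zero P hf0
  have hg0 : g ≠ 0 := left_ne_zero_of_mul (hfgv ▸ hf0)
  have hv0 : v ≠ 0 := right_ne_zero_of_mul (hfgv ▸ hf0)
  by_cases hP : [P] ∈ T
  · have hdes := (hT.1.tail_mul_excEquation hf0 hP).of_associated (mul_ne_zero hf'0 he0) hh
    obtain ⟨T', hT', hsub⟩ := hdes.exists_minimal
    have hf' : strictTransform P f = strictTransform P g * strictTransform P v := by
      rw [hfgv, strictTransform_mul P hg0 hv0]
    obtain ⟨u, hu⟩ := id hh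
    have heq : h = u * strictTransform P g * (strictTransform P v * excEquation P) := by
      rw [← hu, hf']
      ring
    refine ⟨hsq, hmult, hinv, _, _, heq, IsRelPrime.of_squarefree_mul (heq ▸ hsq),
      IsNormalCrossings.mul_of_isUnit_or (mult_excEquation P) (hv.strictTransform P), T', hT',
      fun δ _ hδg q hq hδq D hD => ?_⟩
    have hδg' : δ ∣ strictTransform P g := u.isUnit.dvd_mul_left.1 hδg
    have hgq : ¬ IsUnit (curveAt q (strictTransform P g)) := fun hgu =>
      hδq (isUnit_of_dvd_unit (curveAt_dvd q (strictTransform_ne_zero P hg0) hδg') hgu)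
    have hfq : ¬ IsUnit (curveAt q (strictTransform P f)) := fun hfu =>
      hgq (isUnit_of_dvd_unit (curveAt_dvd q hf'0 (hf' ▸ dvd_mul_right _ _)) hfu)
    have hass : Associated (curveAt q h)
        (curveAt q (strictTransform P f) * curveAt q (excEquation P)) := by
      rw [← curveAt_mul q hf'0 he0]
      exact (curveAt_associated q (mul_ne_zero hf'0 he0) hh).symm
    have hhq := hT'.1.2 q hq
    have he : IsUnit (curveAt q (excEquation P)) := by
      by_contra he
      exact not_isDesingularizedAt_of_mul_dvd hfq he hass.symm.dvd hhq
    exact one_le_kappa_of_strictTransform hT hnil hg0 hX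
      (fun p hp hne => hsub (hq.2 p hp hne))
      (hhq.of_associated (hass.trans (associated_mul_unit_left _ _ he))) he hgq hD
  · have hdes := hT.1.2 [P] (isPointOver_append_singleton (q := []) hT.1.1 hnil hP)
    have htr : AreTransverse (strictTransform P f) (excEquation P) := by
      rcases hdes with hu | ⟨-, -, h3⟩
      · rw [← mult_eq_of_associated hh, mult_mul, mult_excEquation,
          show mult (strictTransform P f) = 0 from mult_eq_zero_iff.2 hu] at hmult
        exact absurd hmult (by decide)
      · exact h3 _ (by rw [excAt_singleton]; rfl)
    obtain ⟨T', hT', -⟩ :=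
      (htr.isDesingularization.of_associated (mul_ne_zero hf'0 he0) hh).exists_minimal
    refine ⟨hsq, hmult, hinv, 1, h, (one_mul h).symm, isRelPrime_one_left,
      IsNormalCrossings.of_associated (Or.inr (Or.inr ⟨_, _, rfl, htr⟩)) hh, T', hT',
      fun δ hδ h1 => absurd (isUnit_of_dvd_one h1) hδ.not_isUnit⟩

/-- The case of an exceptional divisor that is not invariant. The minimal desingularization of the
strict transform may be smaller than the one of `f`, since the branches need not be separated from
the exceptional divisor, but this happens for at most one branch, which is smooth and tangent to the
exceptional divisor; it is added to the normal-crossings part. -/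
theorem isWeaklyIsolated_of_associated_strictTransform {X : VectorField} {f g v h : HolGerm}
    {T : Set (List Direction)} {P : Direction} (hf : 2 ≤ mult f) (hf0 : f ≠ 0) (hfgv : f = g * v)
    (hv : IsNormalCrossings v) (hT : IsMinimalDesingularization f T)
    (hX : ∀ γ, Irreducible γ → γ ∣ g → IsNonNull X T γ) (hsq : Squarefree h) (hmult : 2 ≤ mult h)
    (hinv : IsInvariant (strictField P X) h) (hh : Associated (strictTransform P f) h) :
    IsWeaklyIsolated (strictField P X) h := by
  have hnil := nil_mem_of_two_le_mult hT.1 hf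
  have hf'0 := strictTransform_ne_zero P hf0
  have hg0 : g ≠ 0 := left_ne_zero_of_mul (hfgv ▸ hf0)
  have hv0 : v ≠ 0 := right_ne_zero_of_mul (hfgv ▸ hf0)
  have hv'0 := strictTransform_ne_zero P hv0
  obtain ⟨T', hT', hsub⟩ := ((hT.1.tail hnil P).of_associated hf'0 hh).exists_minimal
  have hnil' := nil_mem_of_two_le_mult hT'.1 hmult
  have hf' : strictTransform P f = strictTransform P g * strictTransform P v := by
    rw [hfgv, strictTransform_mul P hg0 hv0]
  have hdes : ∀ q, IsPointOver T' q → IsDesingularizedAt (strictTransform P f) q := fun q hq =>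
    (hT'.1.2 q hq).of_associated (curveAt_associated q hf'0 hh).symm
  have hvtr := hv.strictTransform P
  obtain ⟨u, hu⟩ := hh
  -- It remains to split `g` into the new important part `g₁` and a part `γ` so that the points of
  -- `g₁` over `T'` are outside the strict transform of the exceptional divisor.
  have key : ∃ g₁ γ, strictTransform P g = g₁ * γ ∧
      IsNormalCrossings (strictTransform P v * γ) ∧
      ∀ q, IsPointOver T' q → ¬ IsUnit (curveAt q g₁) →
        IsUnit (curveAt q (excEquation P)) := by
    by_cases hcorner : ∃ q, IsPointOver T' q ∧ ¬ IsUnit (curveAt q (strictTransform P f)) ∧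
        ¬ IsUnit (curveAt q (excEquation P))
    · obtain ⟨q, hq, hfq, heq⟩ := hcorner
      have hq0 : q ≠ [] := by
        rintro rfl
        exact hq.1 hnil'
      obtain ⟨h1, -, h3⟩ := (hdes q hq).resolve_left hfq
      obtain ⟨γ, hγ1, hγf, hγq, -, hγe⟩ := exists_mult_eq_one_of_dvd_curveAt q (E := ∅)
        (mult_excEquation P) (fun D hD => absurd hD (Set.notMem_empty D)) heq hf'0 h1 dvd_rfl h3
      have hγe := hγe hq0
      have hγu : ¬ IsUnit (curveAt q γ) := fun h => hfq (hγq.isUnit h)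
      have hγ := irreducible_of_mult_eq_one hγ1
      have hγv : ¬ γ ∣ strictTransform P v := by
        intro hdvd
        rcases hvtr with hvu | hvtr
        · exact hγ.not_isUnit (isUnit_of_dvd_unit hdvd hvu)
        · exact hγe (hvtr.of_associated
            (hγ.associated_of_dvd (irreducible_of_mult_eq_one hvtr.1) hdvd).symm)
      obtain ⟨g₁, hg₁⟩ :=
        ((prime_of_irreducible hγ).dvd_or_dvd (hf' ▸ hγf)).resolve_right hγv
      refine ⟨g₁, γ, by rw [hg₁, mul_comm], IsNormalCrossings.mul_of_isUnit_or hγ1 ?_,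
        fun q' hq' hg₁q' => ?_⟩
      · exact hvtr.imp_right fun hvtr => (hvtr.symm.of_not_areTransverse hγ1 hγe).symm
      · by_contra heq'
        obtain rfl : q = q' := by
          by_contra hne
          rcases prefix_or_prefix_of_not_isUnit_curveAt (mult_excEquation P) heq heq' with hp | hp
          · exact hq.1 (hq'.2 q hp hne)
          · exact hq'.1 (hq.2 q' hp (Ne.symm hne))
        have hg'0 := strictTransform_ne_zero P hg0
        refine not_isDesingularizedAt_of_mul_dvd hγu hg₁q' ?_ (hdes q hq)
        rw [← curveAt_mul q (left_ne_zero_of_mul (hg₁ ▸ hg'0))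
          (right_ne_zero_of_mul (hg₁ ▸ hg'0)), ← hg₁]
        exact curveAt_dvd q hf'0 (hf' ▸ dvd_mul_right _ _)
    · refine ⟨strictTransform P g, 1, (mul_one _).symm, ?_, fun q hq hgq => ?_⟩
      · rw [mul_one]
        exact hvtr.imp_right fun hvtr => Or.inl hvtr.1
      · by_contra he
        exact hcorner ⟨q, hq, fun hfu => hgq (isUnit_of_dvd_unit
          (curveAt_dvd q hf'0 (hf' ▸ dvd_mul_right _ _)) hfu), he⟩
  obtain ⟨g₁, γ, hg₁, hnc, hg₁q⟩ := key
  have hg'0 := strictTransform_ne_zero P hg0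
  have hg₁0 : g₁ ≠ 0 := left_ne_zero_of_mul (hg₁ ▸ hg'0)
  have heq : h = u * g₁ * (strictTransform P v * γ) := by
    rw [← hu, hf', hg₁]
    ring
  refine ⟨hsq, hmult, hinv, _, _, heq, IsRelPrime.of_squarefree_mul (heq ▸ hsq), hnc, T', hT',
    fun δ _ hδg q hq hδq D hD => ?_⟩
  have hδg₁ : ¬ IsUnit (curveAt q g₁) := fun hgu =>
    hδq (isUnit_of_dvd_unit (curveAt_dvd q hg₁0 (u.isUnit.dvd_mul_left.1 hδg)) hgu)
  have hgq : ¬ IsUnit (curveAt q (strictTransform P g)) := fun hgu =>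
    hδg₁ (isUnit_of_dvd_unit (curveAt_dvd q hg'0 (hg₁ ▸ dvd_mul_right _ _)) hgu)
  exact one_le_kappa_of_strictTransform hT hnil hg0 hX (fun p hp hne => hsub (hq.2 p hp hne))
    (hdes q hq) (hg₁q q hq hδg₁) hgq hD

end FolGerm

end

theorem mainTheorem5 (X : FolGerm.VectorField) (hX : IsRelPrime X.1 X.2)
    (f : FolGerm.HolGerm) (hf : FolGerm.IsWeaklyIsolated X f)
    (P : FolGerm.Direction) (h : FolGerm.HolGerm)
    (hh : FolGerm.IsInvariantTotalTransform X f P h) (hsing : 2 ≤ FolGerm.mult h) :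
    FolGerm.IsWeaklyIsolated (FolGerm.strictField P X) h := by
  obtain ⟨hsq, hmult, hinv, g, v, hfgv, -, hv, T, hT, hnn⟩ := hf
  have hf0 : f ≠ 0 := hsq.ne_zero
  have hX0 : X.1 ≠ 0 ∨ X.2 ≠ 0 := by
    by_contra! hcon
    rw [hcon.1, hcon.2, isRelPrime_zero_left] at hX
    exact not_isUnit_zero hX
  have hnil := FolGerm.nil_mem_of_two_le_mult hT.1 hmult
  have hsq' := (hT.1.tail hnil P).squarefree (FolGerm.strictTransform_ne_zero P hf0)
  have hinv' := FolGerm.isInvariant_strictTransform P hX0 hf0 hinv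
  obtain ⟨h1, h2⟩ := hh.associated (le_trans (by decide) hmult) hf0 hsq' hinv'
  by_cases he : FolGerm.IsInvariant (FolGerm.strictField P X) (FolGerm.excEquation P)
  · exact FolGerm.isWeaklyIsolated_of_associated_mul_excEquation hmult hf0 hfgv hv hT hnn hh.1 hsing
      ((hinv'.mul he).of_associated (h1 he).symm) (h1 he).symm
  · exact FolGerm.isWeaklyIsolated_of_associated_strictTransform hmult hf0 hfgv hv hT hnn hh.1 hsing
      (hinv'.of_associated (h2 he).symm) (h2 he).symm
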